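/- Let $N=2^n$ with $n\ge 1$, and let $\mathfrak p$ be a prime ideal of $\mathbb Z[x]/(x^N+1)$ containing a rational prime $p\equiv\pm3\pmod 8$. Regard $\mathfrak p$ as a lattice in $\mathbb R^N$ through the coefficient embedding $a_0+a_1x+\dots+a_{N-1}x^{N-1}\mapsto(a_0,\dots,a_{N-1})$, with the Euclidean norm. (1) A shortest nonzero vector of $\mathfrak p$ can be found in time $\mathrm{poly}(N,\log p)$: there are a single program (for a random access machine in which every operation is charged according to the bit lengths of the integers involved) and a polynomial $B$ such that, for all such $n$, $p$, $\mathfrak p$ and every $g=g_0+g_1x+\dots+g_{N-1}x^{N-1}$ with integer coefficients $|g_i|<p$ and $\mathfrak p=(p,g)$, the program on input $(N,p,(g_0,\dots,g_{N-1}))$ halts after time at most $B(N,\lfloor\log_2 p\rfloor)$ and outputs a shortest nonzero vector of $\mathfrak p$. (2) Except when $N=2$ and $p\equiv 3\pmod 8$, the length of a shortest nonzero vector of $\mathfrak p$ is exactly $\sqrt p$. -/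

import Mathlib

namespace IdealSVP

open Polynomial

/-! ### A random access machine with bit costs

Programs are structured (`while`) programs over finitely many integer registers and one
random access memory with integer cells, starting at zero outside the input.
Every elementary operation is charged
according to the bit lengths of the integers (operands, addresses, stored values) involved: this is
the logarithmic cost criterion, with multiplication and division charged the product of the bit
lengths of their operands. -/

/-- Bit length of an integer, with one extra bit for the sign. -/
def bitLen (z : ℤ) : ℕ := Nat.size z.natAbs + 1

/-- Expressions. -/
inductive Expr : Type where
  /-- an integer constant of the program -/
  | const (z : ℤ)
  /-- the content of a register -/
  | reg (r : ℕ)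
  /-- the content of the memory cell whose address is the value of an expression -/
  | load (e : Expr)
  | add (e₁ e₂ : Expr)
  | sub (e₁ e₂ : Expr)
  | mul (e₁ e₂ : Expr)
  /-- Euclidean quotient (`0` if the divisor is `0`) -/
  | div (e₁ e₂ : Expr)
  /-- Euclidean remainder (the dividend if the divisor is `0`) -/
  | mod (e₁ e₂ : Expr)

/-- Programs. A test `e` succeeds if the value of `e` is positive. -/
inductive Prog : Type where
  | skip
  /-- `assign r e` puts the value of `e` into register `r`. -/
  | assign (r : ℕ) (e : Expr)
  /-- `store a e` puts the value of `e` into the memory cell whose address is the value of `a`. -/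
  | store (a e : Expr)
  | seq (c₁ c₂ : Prog)
  | ite (e : Expr) (c₁ c₂ : Prog)
  | while (e : Expr) (c : Prog)

/-- States of the machine: contents of the registers and of the memory. -/
@[ext]
structure State where
  reg : ℕ → ℤ
  mem : ℤ → ℤ

/-- Put `z` into register `r`. -/
def State.setReg (s : State) (r : ℕ) (z : ℤ) : State :=
  ⟨Function.update s.reg r z, s.mem⟩

/-- Put `z` into the memory cell with address `a`. -/
def State.setMem (s : State) (a z : ℤ) : State :=
  ⟨s.reg, Function.update s.mem a z⟩

/-- The value of an expression. -/
def Expr.eval (s : State) : Expr → ℤ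
  | const z => z
  | reg r => s.reg r
  | load e => s.mem (e.eval s)
  | add e₁ e₂ => e₁.eval s + e₂.eval s
  | sub e₁ e₂ => e₁.eval s - e₂.eval s
  | mul e₁ e₂ => e₁.eval s * e₂.eval s
  | div e₁ e₂ => e₁.eval s / e₂.eval s
  | mod e₁ e₂ => e₁.eval s % e₂.eval s

/-- The cost of evaluating an expression. -/
def Expr.cost (s : State) : Expr → ℕ
  | const z => bitLen z
  | reg r => bitLen (s.reg r)
  | load e => e.cost s + bitLen (e.eval s) + bitLen (s.mem (e.eval s))
  | add e₁ e₂ => e₁.cost s + e₂.cost s + (bitLen (e₁.eval s) + bitLen (e₂.eval s))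
  | sub e₁ e₂ => e₁.cost s + e₂.cost s + (bitLen (e₁.eval s) + bitLen (e₂.eval s))
  | mul e₁ e₂ => e₁.cost s + e₂.cost s + bitLen (e₁.eval s) * bitLen (e₂.eval s)
  | div e₁ e₂ => e₁.cost s + e₂.cost s + bitLen (e₁.eval s) * bitLen (e₂.eval s)
  | mod e₁ e₂ => e₁.cost s + e₂.cost s + bitLen (e₁.eval s) * bitLen (e₂.eval s)

/-- `Exec c s t s'`: started in state `s`, the program `c` halts in state `s'` after time `t`. -/
inductive Exec : Prog → State → ℕ → State → Prop where
  | skip (s : State) : Exec .skip s 1 s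
  | assign (r : ℕ) (e : Expr) (s : State) :
      Exec (.assign r e) s (e.cost s + bitLen (e.eval s)) (s.setReg r (e.eval s))
  | store (a e : Expr) (s : State) :
      Exec (.store a e) s (a.cost s + e.cost s + (bitLen (a.eval s) + bitLen (e.eval s)))
        (s.setMem (a.eval s) (e.eval s))
  | seq {c₁ c₂ : Prog} {s₁ s₂ s₃ : State} {t₁ t₂ : ℕ}
      (h₁ : Exec c₁ s₁ t₁ s₂) (h₂ : Exec c₂ s₂ t₂ s₃) : Exec (.seq c₁ c₂) s₁ (t₁ + t₂) s₃
  | ite_true {e : Expr} {c₁ c₂ : Prog} {s s' : State} {t : ℕ}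
      (he : 0 < e.eval s) (h : Exec c₁ s t s') : Exec (.ite e c₁ c₂) s (e.cost s + 1 + t) s'
  | ite_false {e : Expr} {c₁ c₂ : Prog} {s s' : State} {t : ℕ}
      (he : ¬ 0 < e.eval s) (h : Exec c₂ s t s') : Exec (.ite e c₁ c₂) s (e.cost s + 1 + t) s'
  | while_true {e : Expr} {c : Prog} {s₁ s₂ s₃ : State} {t₁ t₂ : ℕ}
      (he : 0 < e.eval s₁) (h₁ : Exec c s₁ t₁ s₂) (h₂ : Exec (.while e c) s₂ t₂ s₃) :
      Exec (.while e c) s₁ (e.cost s₁ + 1 + t₁ + t₂) s₃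
  | while_false {e : Expr} {c : Prog} {s : State} (he : ¬ 0 < e.eval s) :
      Exec (.while e c) s (e.cost s + 1) s

/-- The initial state on input `(N, p, g)`: register `0` holds `N`, register `1` holds `p`, the
memory cells `0, …, N - 1` hold the entries of `g`, everything else is `0`. -/
def inputState (N p : ℕ) (g : Fin N → ℤ) : State where
  reg r := if r = 0 then (N : ℤ) else if r = 1 then (p : ℤ) else 0
  mem a := if h : 0 ≤ a ∧ a.toNat < N then g ⟨a.toNat, h.2⟩ else 0

/-- The output: the integer vector held by the memory cells `0, …, N - 1`. -/
def outputVec (N : ℕ) (s : State) : Fin N → ℤ := fun i => s.mem ((i : ℕ) : ℤ)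

/-! ### The ring `ℤ[x]/(x^N + 1)`, the coefficient embedding, and ideal lattices -/

/-- The polynomial `x^N + 1`, where `N = 2^n`. -/
noncomputable abbrev cycPoly (n : ℕ) : ℤ[X] := X ^ 2 ^ n + 1

theorem cycPoly_monic (n : ℕ) : (cycPoly n).Monic := by
  simpa using monic_X_pow_add_C (1 : ℤ) (n := 2 ^ n) (by positivity)

/-- The ring `ℤ[x]/(x^N + 1)`, where `N = 2^n`. -/
abbrev CycRing (n : ℕ) : Type := AdjoinRoot (cycPoly n)

/-- The element `g₀ + g₁ x + ⋯ + g_{N-1} x^{N-1}` of `ℤ[x]/(x^N + 1)`. -/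
noncomputable def ofCoeffs (n : ℕ) (g : Fin (2 ^ n) → ℤ) : CycRing n :=
  AdjoinRoot.mk (cycPoly n) (∑ i, C (g i) * X ^ (i : ℕ))

/-- An integer vector, as an element of Euclidean space. -/
noncomputable def toEuclidean {N : ℕ} (v : Fin N → ℤ) : EuclideanSpace ℝ (Fin N) :=
  WithLp.toLp 2 fun i => (v i : ℝ)

/-- The coefficient embedding: an element of `ℤ[x]/(x^N + 1)` is sent to the vector of coefficients
of its representative of degree less than `N`. -/
noncomputable def coeffEmbedding (n : ℕ) : CycRing n →+ EuclideanSpace ℝ (Fin (2 ^ n)) where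
  toFun a := toEuclidean fun i => (AdjoinRoot.modByMonicHom (cycPoly_monic n) a).coeff i
  map_zero' := by ext i; simp [toEuclidean]
  map_add' a b := by ext i; simp [toEuclidean]

/-- The lattice of an ideal under the coefficient embedding. -/
noncomputable def idealLattice {n : ℕ} (I : Ideal (CycRing n)) :
    AddSubgroup (EuclideanSpace ℝ (Fin (2 ^ n))) :=
  (Submodule.toAddSubgroup I).map (coeffEmbedding n)

/-- `v` is a shortest nonzero vector of `L`. -/
def IsShortestVector {N : ℕ} (L : AddSubgroup (EuclideanSpace ℝ (Fin N)))
    (v : EuclideanSpace ℝ (Fin N)) : Prop :=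
  v ∈ L ∧ v ≠ 0 ∧ ∀ w ∈ L, w ≠ 0 → ‖v‖ ≤ ‖w‖

end IdealSVP

/-! Let d = 1 if p ≡ 5 and d = 2 if p ≡ 3 modulo 8. Then -d is a square modulo p, and Fermat descent
gives p = a² + d b². The ring R = ℤ[x]/(x^N + 1) contains a square root s of -d, namely x^(N/2) for
d = 1 and x^(N/4) + x^(3N/4) for d = 2; the latter needs 4 ∣ N.

Multiplication by x permutes the coordinates up to a sign, so it is an isometry, and multiplication
by s is skew-adjoint. Hence π = a + b s multiplies every squared length by a² + d b² = p
(`IsStep.dot_gen_mul`): the lattice πR is a copy of ℤ^N scaled by √p, and π is a shortest vector of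
it.

Since (a + b s)(a - b s) = p, the prime 𝔭 contains one of the two factors, and this factor π
generates it (`Compatible.eq_span_gen`). Indeed x satisfies a monic equation of degree N/2 modulo π,
while it satisfies no equation of smaller degree modulo 𝔭, because p has order at least N/2 modulo
2N (`Compatible.le_orderOf`, `Compatible.dvd_of_mem`).

In the exceptional case N = 2, p ≡ 3 modulo 8, the ring is ℤ[i], p is inert and p itself is
shortest.

All of this is effective without randomness. Euler's criterion makes a fixed power of 2 or -2 a
square root of -d; the descent shrinks geometrically; and the sign of b is decided by whether p
divides (a - b s) g (`Compatible.gen_mem_iff`). The loops run O(N + log p) times on numbers of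
O(log(N p)) bits. -/

namespace IdealSVP

/-! ### Bit lengths and costs -/

theorem one_le_bitLen (z : ℤ) : 1 ≤ bitLen z := by
  unfold bitLen; omega

theorem bitLen_mono {a b : ℤ} (h : |a| ≤ |b|) : bitLen a ≤ bitLen b := by
  unfold bitLen
  have : a.natAbs ≤ b.natAbs := by rwa [Int.abs_eq_natAbs, Int.abs_eq_natAbs, Nat.cast_le] at h
  have := Nat.size_le_size this
  omega

theorem size_add_le (m n : ℕ) : (m + n).size ≤ m.size + n.size + 1 := by
  rw [Nat.size_le]
  have h₁ := Nat.lt_size_self m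
  have h₂ := Nat.lt_size_self n
  have h₃ : 2 ^ m.size ≤ 2 ^ (m.size + n.size) := Nat.pow_le_pow_right (by norm_num) (by omega)
  have h₄ : 2 ^ n.size ≤ 2 ^ (m.size + n.size) := Nat.pow_le_pow_right (by norm_num) (by omega)
  rw [pow_succ]
  omega

theorem size_mul_le (m n : ℕ) : (m * n).size ≤ m.size + n.size := by
  rw [Nat.size_le, pow_add]
  exact Nat.mul_lt_mul'' (Nat.lt_size_self m) (Nat.lt_size_self n)

theorem bitLen_add_le (a b : ℤ) : bitLen (a + b) ≤ bitLen a + bitLen b := by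
  unfold bitLen
  have h := Nat.size_le_size (Int.natAbs_add_le a b)
  have := size_add_le a.natAbs b.natAbs
  omega

theorem bitLen_sub_le (a b : ℤ) : bitLen (a - b) ≤ bitLen a + bitLen b := by
  have := bitLen_add_le a (-b)
  rw [← sub_eq_add_neg] at this
  simpa [bitLen] using this

theorem bitLen_mul_le (a b : ℤ) : bitLen (a * b) ≤ bitLen a + bitLen b := by
  unfold bitLen
  rw [Int.natAbs_mul]
  have := size_mul_le a.natAbs b.natAbs
  omega

theorem bitLen_div_le (a b : ℤ) : bitLen (a / b) ≤ bitLen a + bitLen b := by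
  have : bitLen (a / b) ≤ bitLen a := bitLen_mono (by
    rw [Int.abs_eq_natAbs, Int.abs_eq_natAbs, Nat.cast_le]
    exact Int.natAbs_ediv_le_natAbs a b)
  omega

theorem bitLen_mod_le (a b : ℤ) : bitLen (a % b) ≤ bitLen a + bitLen b := by
  rcases eq_or_ne b 0 with rfl | hb
  · simp
  · have : bitLen (a % b) ≤ bitLen b := bitLen_mono (by
      rw [abs_of_nonneg (Int.emod_nonneg a hb)]
      exact (Int.emod_lt_abs a hb).le)
    omega

/-- All registers and memory cells are bounded by `V` in absolute value. -/
def State.Bdd (V : ℤ) (s : State) : Prop :=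
  (∀ r, |s.reg r| ≤ V) ∧ ∀ a, |s.mem a| ≤ V

theorem State.Bdd.nonneg {V : ℤ} {s : State} (h : s.Bdd V) : 0 ≤ V :=
  (abs_nonneg _).trans (h.1 0)

theorem State.Bdd.setReg {V : ℤ} {s : State} (h : s.Bdd V) {r : ℕ} {z : ℤ} (hz : |z| ≤ V) :
    (s.setReg r z).Bdd V := by
  refine ⟨fun q => ?_, h.2⟩
  by_cases hq : q = r
  · subst hq; simpa [State.setReg] using hz
  · simpa [State.setReg, hq] using h.1 q

theorem State.Bdd.setMem {V : ℤ} {s : State} (h : s.Bdd V) {a z : ℤ} (hz : |z| ≤ V) :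
    (s.setMem a z).Bdd V := by
  refine ⟨h.1, fun q => ?_⟩
  by_cases hq : q = a
  · subst hq; simpa [State.setMem] using hz
  · simpa [State.setMem, hq] using h.2 q

/-- The shape of `e` is fixed, so bit lengths grow only by a constant factor along it; charging
products of bit lengths makes the cost quadratic. The constant depends on `e` alone, not on `V`. -/
theorem Expr.exists_cost_le (e : Expr) : ∃ k : ℕ, ∀ (V : ℤ) (s : State), s.Bdd V →
    bitLen (e.eval s) ≤ k * bitLen V ∧ e.cost s ≤ k * bitLen V ^ 2 := by
  -- All binary operations at once: the constant covers a charge by the product as well as by the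
  -- sum of the bit lengths.
  have hbin : ∀ {b₁ b₂ c₁ c₂ k₁ k₂ b c x W : ℕ}, 1 ≤ W → b₁ ≤ k₁ * W → c₁ ≤ k₁ * W ^ 2 →
      b₂ ≤ k₂ * W → c₂ ≤ k₂ * W ^ 2 → b ≤ b₁ + b₂ → c = c₁ + c₂ + x →
      (x ≤ b₁ * b₂ ∨ x ≤ b₁ + b₂) →
      b ≤ (2 * k₁ + 2 * k₂ + k₁ * k₂) * W ∧ c ≤ (2 * k₁ + 2 * k₂ + k₁ * k₂) * W ^ 2 := by
    intro b₁ b₂ c₁ c₂ k₁ k₂ b c x W hW h₁ h₂ h₃ h₄ h₅ h₆ h₇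
    have hx : x ≤ (k₁ + k₂ + k₁ * k₂) * W ^ 2 := by
      rcases h₇ with h | h
      · have := Nat.mul_le_mul h₁ h₃
        nlinarith [Nat.zero_le (k₁ * W ^ 2), Nat.zero_le (k₂ * W ^ 2)]
      · have h₈ : W ≤ W ^ 2 := by nlinarith
        have h₉ := Nat.mul_le_mul_left k₁ h₈
        have h₁₀ := Nat.mul_le_mul_left k₂ h₈
        nlinarith [Nat.zero_le (k₁ * k₂ * W ^ 2)]
    constructor
    · nlinarith [Nat.zero_le (k₁ * k₂ * W), Nat.zero_le (k₁ * W), Nat.zero_le (k₂ * W)]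
    · subst h₆
      nlinarith
  induction e with
  | const z =>
    refine ⟨bitLen z, fun V s h => ?_⟩
    have hW := one_le_bitLen V
    exact ⟨Nat.le_mul_of_pos_right _ hW, Nat.le_mul_of_pos_right _ (by positivity)⟩
  | reg r =>
    refine ⟨1, fun V s h => ?_⟩
    have hW := one_le_bitLen V
    have h₁ : bitLen (s.reg r) ≤ bitLen V :=
      bitLen_mono ((h.1 r).trans (le_abs_self V))
    simp only [Expr.eval, Expr.cost]
    constructor <;> nlinarith
  | load e ih =>
    obtain ⟨k, hk⟩ := ih
    refine ⟨2 * k + 1, fun V s h => ?_⟩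
    have hW := one_le_bitLen V
    obtain ⟨h₁, h₂⟩ := hk V s h
    have h₃ : bitLen (s.mem (e.eval s)) ≤ bitLen V :=
      bitLen_mono ((h.2 _).trans (le_abs_self V))
    have h₄ : bitLen V ≤ bitLen V ^ 2 := by nlinarith
    have h₅ := Nat.mul_le_mul_left k h₄
    simp only [Expr.eval, Expr.cost]
    constructor
    · nlinarith [Nat.zero_le (k * bitLen V)]
    · nlinarith
  | add e₁ e₂ ih₁ ih₂ =>
    obtain ⟨k₁, h₁⟩ := ih₁
    obtain ⟨k₂, h₂⟩ := ih₂
    exact ⟨_, fun V s h => hbin (one_le_bitLen V) (h₁ V s h).1 (h₁ V s h).2 (h₂ V s h).1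
      (h₂ V s h).2 (bitLen_add_le _ _) rfl (.inr le_rfl)⟩
  | sub e₁ e₂ ih₁ ih₂ =>
    obtain ⟨k₁, h₁⟩ := ih₁
    obtain ⟨k₂, h₂⟩ := ih₂
    exact ⟨_, fun V s h => hbin (one_le_bitLen V) (h₁ V s h).1 (h₁ V s h).2 (h₂ V s h).1
      (h₂ V s h).2 (bitLen_sub_le _ _) rfl (.inr le_rfl)⟩
  | mul e₁ e₂ ih₁ ih₂ =>
    obtain ⟨k₁, h₁⟩ := ih₁
    obtain ⟨k₂, h₂⟩ := ih₂
    exact ⟨_, fun V s h => hbin (one_le_bitLen V) (h₁ V s h).1 (h₁ V s h).2 (h₂ V s h).1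
      (h₂ V s h).2 (bitLen_mul_le _ _) rfl (.inl le_rfl)⟩
  | div e₁ e₂ ih₁ ih₂ =>
    obtain ⟨k₁, h₁⟩ := ih₁
    obtain ⟨k₂, h₂⟩ := ih₂
    exact ⟨_, fun V s h => hbin (one_le_bitLen V) (h₁ V s h).1 (h₁ V s h).2 (h₂ V s h).1
      (h₂ V s h).2 (bitLen_div_le _ _) rfl (.inl le_rfl)⟩
  | mod e₁ e₂ ih₁ ih₂ =>
    obtain ⟨k₁, h₁⟩ := ih₁
    obtain ⟨k₂, h₂⟩ := ih₂
    exact ⟨_, fun V s h => hbin (one_le_bitLen V) (h₁ V s h).1 (h₁ V s h).2 (h₂ V s h).1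
      (h₂ V s h).2 (bitLen_mod_le _ _) rfl (.inl le_rfl)⟩

/-! ### Total correctness with time bounds -/

/-- Started in `s`, the program `c` halts after time at most `T` in a state that is bounded by `V`
and satisfies `Q`. -/
def Runs (V : ℤ) (c : Prog) (T : ℕ) (s : State) (Q : State → Prop) : Prop :=
  ∃ (t : ℕ) (s' : State), Exec c s t s' ∧ t ≤ T ∧ s'.Bdd V ∧ Q s'

theorem Runs.seq {V : ℤ} {c₁ c₂ : Prog} {T₁ T₂ : ℕ} {s : State} {P Q : State → Prop}
    (h₁ : Runs V c₁ T₁ s P) (h₂ : ∀ s', s'.Bdd V → P s' → Runs V c₂ T₂ s' Q) :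
    Runs V (.seq c₁ c₂) (T₁ + T₂) s Q := by
  obtain ⟨t, s', he, ht, hb, hP⟩ := h₁
  obtain ⟨t', s'', he', ht', hb', hQ⟩ := h₂ s' hb hP
  exact ⟨t + t', s'', .seq he he', by omega, hb', hQ⟩

/-- Weakest precondition of a loop-free program, including that all assigned values are bounded
by `V`. -/
def wp (V : ℤ) : Prog → (State → Prop) → State → Prop
  | .skip, Q, s => Q s
  | .assign r e, Q, s => |e.eval s| ≤ V ∧ Q (s.setReg r (e.eval s))
  | .store a e, Q, s => |e.eval s| ≤ V ∧ Q (s.setMem (a.eval s) (e.eval s))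
  | .seq c₁ c₂, Q, s => wp V c₁ (wp V c₂ Q) s
  | .ite e c₁ c₂, Q, s => (0 < e.eval s → wp V c₁ Q s) ∧ (¬ 0 < e.eval s → wp V c₂ Q s)
  | .while _ _, _, _ => False

/-- The constant is chosen before `V`, so one program has one constant for inputs of all sizes. -/
theorem exists_runs_of_wp (c : Prog) : ∃ k : ℕ, ∀ (V : ℤ) (s : State) (Q : State → Prop),
    s.Bdd V → wp V c Q s → Runs V c (k * bitLen V ^ 2) s Q := by
  induction c with
  | skip =>
    refine ⟨1, fun V s Q hb hw => ⟨1, s, .skip s, ?_, hb, hw⟩⟩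
    have := one_le_bitLen V
    nlinarith
  | assign r e =>
    obtain ⟨k, hk⟩ := e.exists_cost_le
    refine ⟨k + 1, fun V s Q hb hw => ⟨_, _, .assign r e s, ?_, hb.setReg hw.1, hw.2⟩⟩
    have h₁ := one_le_bitLen V
    have h₂ := (hk V s hb).2
    have h₃ : bitLen (e.eval s) ≤ bitLen V := bitLen_mono (hw.1.trans (le_abs_self V))
    nlinarith
  | store a e =>
    obtain ⟨k, hk⟩ := e.exists_cost_le
    obtain ⟨l, hl⟩ := a.exists_cost_le
    refine ⟨k + 2 * l + 1, fun V s Q hb hw => ⟨_, _, .store a e s, ?_, hb.setMem hw.1, hw.2⟩⟩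
    have h₁ := one_le_bitLen V
    have h₂ := (hk V s hb).2
    have h₃ : bitLen (e.eval s) ≤ bitLen V := bitLen_mono (hw.1.trans (le_abs_self V))
    obtain ⟨h₄, h₅⟩ := hl V s hb
    have h₆ : bitLen V ≤ bitLen V ^ 2 := by nlinarith
    have h₇ := Nat.mul_le_mul_left l h₆
    nlinarith
  | seq c₁ c₂ ih₁ ih₂ =>
    obtain ⟨k₁, h₁⟩ := ih₁
    obtain ⟨k₂, h₂⟩ := ih₂
    refine ⟨k₁ + k₂, fun V s Q hb hw => ?_⟩
    rw [add_mul]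
    exact (h₁ V s _ hb hw).seq fun s' hb' hw' => h₂ V s' Q hb' hw'
  | ite e c₁ c₂ ih₁ ih₂ =>
    obtain ⟨k, hk⟩ := e.exists_cost_le
    obtain ⟨k₁, h₁⟩ := ih₁
    obtain ⟨k₂, h₂⟩ := ih₂
    refine ⟨k + 1 + k₁ + k₂, fun V s Q hb hw => ?_⟩
    have h₃ := one_le_bitLen V
    have h₄ := (hk V s hb).2
    have h₅ : 1 ≤ bitLen V ^ 2 := Nat.one_le_pow _ _ h₃
    by_cases he : 0 < e.eval s
    · obtain ⟨t, s', hx, ht, hb', hQ⟩ := h₁ V s Q hb (hw.1 he)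
      refine ⟨_, s', .ite_true he hx, ?_, hb', hQ⟩
      nlinarith [Nat.zero_le (k₂ * bitLen V ^ 2)]
    · obtain ⟨t, s', hx, ht, hb', hQ⟩ := h₂ V s Q hb (hw.2 he)
      refine ⟨_, s', .ite_false he hx, ?_, hb', hQ⟩
      nlinarith [Nat.zero_le (k₁ * bitLen V ^ 2)]
  | _ e c _ => exact ⟨0, fun V s Q hb hw => hw.elim⟩

/-- A loop with loop-free body, an invariant `I` and a decreasing measure `μ`. -/
theorem exists_runs_while (e : Expr) (c : Prog) : ∃ k : ℕ, ∀ (V : ℤ) (I : State → Prop)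
    (μ : State → ℕ),
    (∀ s, s.Bdd V → I s → 0 < e.eval s → wp V c (fun s' => I s' ∧ μ s' < μ s) s) →
    ∀ s : State, s.Bdd V → I s →
      Runs V (.while e c) ((μ s + 1) * (k * bitLen V ^ 2)) s fun s' => I s' ∧ ¬ 0 < e.eval s' := by
  obtain ⟨k₁, h₁⟩ := e.exists_cost_le
  obtain ⟨k₂, h₂⟩ := exists_runs_of_wp c
  refine ⟨k₁ + 1 + k₂, fun V I μ hstep s => ?_⟩
  induction h : μ s using Nat.strong_induction_on generalizing s with
  | _ l ih =>
    intro hb hI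
    subst h
    have h₃ : 1 ≤ bitLen V ^ 2 := Nat.one_le_pow _ _ (one_le_bitLen V)
    have h₄ := (h₁ V s hb).2
    set Y := bitLen V ^ 2 with hY
    have hexp : (k₁ + 1 + k₂) * Y = k₁ * Y + Y + k₂ * Y := by ring
    by_cases he : 0 < e.eval s
    · obtain ⟨t, s', hx, ht, hb', hI', hμ⟩ := h₂ V s _ hb (hstep s hb hI he)
      obtain ⟨t', s'', hx', ht', hb'', hQ⟩ := ih _ hμ s' rfl hb' hI'
      refine ⟨_, s'', .while_true he hx hx', ?_, hb'', hQ⟩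
      have : (μ s' + 1) * ((k₁ + 1 + k₂) * Y) ≤ μ s * ((k₁ + 1 + k₂) * Y) :=
        Nat.mul_le_mul_right _ hμ
      rw [← hY] at ht
      rw [add_mul (μ s), one_mul]
      omega
    · refine ⟨_, s, .while_false he, ?_, hb, hI, he⟩
      rw [add_mul, one_mul]
      omega

theorem Runs.mono {V : ℤ} {c : Prog} {T T' : ℕ} {s : State} {P Q : State → Prop}
    (h : Runs V c T s P) (hT : T ≤ T') (hPQ : ∀ s', s'.Bdd V → P s' → Q s') :
    Runs V c T' s Q := by
  obtain ⟨t, s', he, ht, hb, hP⟩ := h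
  exact ⟨t, s', he, ht.trans hT, hb, hPQ s' hb hP⟩

end IdealSVP

namespace IdealSVP

/-! ### Arithmetic of primes congruent to `±3` modulo `8` -/

/-- Here 2 is a non-residue, so Euler's criterion gives 2^((p-1)/2) = -1, and (p-1)/2 is even. -/
theorem two_pow_sq_eq_neg_one {p : ℕ} (hp : p.Prime) (h : p % 8 = 5) :
    ((2 : ZMod p) ^ (p / 4)) ^ 2 = -1 := by
  have := Fact.mk hp
  have h₁ := legendreSym.eq_pow p 2
  rw [legendreSym.at_two (by omega), ZMod.χ₈_nat_eq_if_mod_eight, if_neg (by omega),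
    if_neg (by omega)] at h₁
  rw [← pow_mul, show p / 4 * 2 = p / 2 by omega]
  simpa using h₁.symm

/-- Here -2 is a residue, so (-2)^((p-1)/2) = 1; multiplying by -2 makes the exponent (p+1)/2 even.
-/
theorem neg_two_pow_sq_eq_neg_two {p : ℕ} (hp : p.Prime) (h : p % 8 = 3) :
    ((-2 : ZMod p) ^ (p / 4 + 1)) ^ 2 = -2 := by
  have := Fact.mk hp
  have h₁ := legendreSym.eq_pow p (-2)
  rw [legendreSym.at_neg_two (by omega), ZMod.χ₈'_nat_eq_if_mod_eight, if_neg (by omega),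
    if_pos (by omega)] at h₁
  rw [← pow_mul, show (p / 4 + 1) * 2 = p / 2 + 1 by omega, pow_succ]
  have h₂ : (-2 : ZMod p) ^ (p / 2) = 1 := by simpa using h₁.symm
  rw [h₂, one_mul]

/-- `p` is `3` modulo `8` and `d = 2`, or `p` is `5` modulo `8` and `d = 1`; in both cases `-d`
is a square modulo `p`. -/
def Compatible (p : ℕ) (d : ℤ) : Prop :=
  p.Prime ∧ (p % 8 = 3 ∧ d = 2 ∨ p % 8 = 5 ∧ d = 1)

/-- The base 6 - 4d is -2 for d = 2 and 2 for d = 1, and the exponent is (p+1)/4 or (p-1)/4. One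
formula serves both residue classes, so the program need not branch. -/
theorem Compatible.dvd_sq_add {p : ℕ} {d u : ℤ} (h : Compatible p d)
    (hu : (u : ZMod p) = ((6 - 4 * d : ℤ) : ZMod p) ^ (p / 4 + (d - 1).toNat)) :
    (p : ℤ) ∣ u ^ 2 + d := by
  rw [← ZMod.intCast_zmod_eq_zero_iff_dvd]
  obtain ⟨hp, ⟨h, rfl⟩ | ⟨h, rfl⟩⟩ := h
  · have := neg_two_pow_sq_eq_neg_two hp h
    norm_num at hu
    push_cast
    rw [hu, this]
    ring
  · have := two_pow_sq_eq_neg_one hp h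
    norm_num at hu
    push_cast
    rw [hu, this]
    ring

/-- Multiply x² + d y² = m p by r² + d t² with Brahmagupta's identity and divide by m²; the
congruences make both new coordinates divisible by m. As r² + d t² ≤ (1 + d) m²/4 with d ≤ 2, the
multiplier shrinks at least by the factor 3/4. -/
theorem descent_step {p x y m d r t : ℤ} (hp : Prime p) (hd₁ : 1 ≤ d) (hd₂ : d ≤ 2)
    (h : x ^ 2 + d * y ^ 2 = m * p) (hm : 1 < m) (hmp : m < p)
    (hr : m ∣ x - r) (ht : m ∣ y - t) (hr' : 2 * |r| ≤ m) (ht' : 2 * |t| ≤ m) :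
    ((x * r + d * y * t) / m) ^ 2 + d * ((x * t - y * r) / m) ^ 2 =
        (r ^ 2 + d * t ^ 2) / m * p ∧
      0 < (r ^ 2 + d * t ^ 2) / m ∧ 4 * ((r ^ 2 + d * t ^ 2) / m) ≤ 3 * m := by
  obtain ⟨a, ha⟩ := hr
  obtain ⟨b, hb⟩ := ht
  obtain rfl : r = x - m * a := by linarith
  obtain rfl : t = y - m * b := by linarith
  have e₁ : x * (x - m * a) + d * y * (y - m * b) = m * (p - a * x - d * b * y) := by
    linear_combination h
  have e₂ : x * (y - m * b) - y * (x - m * a) = m * (y * a - x * b) := by ring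
  have e₃ : (x - m * a) ^ 2 + d * (y - m * b) ^ 2 =
      m * (p - 2 * a * x - 2 * d * b * y + m * (a ^ 2 + d * b ^ 2)) := by
    linear_combination h
  have hm0 : m ≠ 0 := by omega
  have hr2 : 4 * (x - m * a) ^ 2 ≤ m ^ 2 := by
    nlinarith [sq_abs (x - m * a), abs_nonneg (x - m * a)]
  have ht2 : 4 * (y - m * b) ^ 2 ≤ m ^ 2 := by
    nlinarith [sq_abs (y - m * b), abs_nonneg (y - m * b)]
  have hle : 4 * ((x - m * a) ^ 2 + d * (y - m * b) ^ 2) ≤ 3 * m ^ 2 := by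
    nlinarith [sq_nonneg (y - m * b)]
  have hnn : 0 ≤ (x - m * a) ^ 2 + d * (y - m * b) ^ 2 := by positivity
  rw [e₁, e₂]
  rw [e₃] at hle hnn ⊢
  rw [Int.mul_ediv_cancel_left _ hm0, Int.mul_ediv_cancel_left _ hm0,
    Int.mul_ediv_cancel_left _ hm0]
  set q := p - 2 * a * x - 2 * d * b * y + m * (a ^ 2 + d * b ^ 2) with hq
  refine ⟨?_, ?_, ?_⟩
  · apply mul_left_cancel₀ (pow_ne_zero 2 hm0)
    calc m ^ 2 * ((p - a * x - d * b * y) ^ 2 + d * (y * a - x * b) ^ 2)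
        = (m * (p - a * x - d * b * y)) ^ 2 + d * (m * (y * a - x * b)) ^ 2 := by ring
      _ = (x ^ 2 + d * y ^ 2) * ((x - m * a) ^ 2 + d * (y - m * b) ^ 2) := by
        rw [← e₁, ← e₂]; ring
      _ = m ^ 2 * (q * p) := by rw [h, e₃]; ring
  -- A new multiplier 0 would force r = t = 0, hence m² ∣ m p and m ∣ p, against 1 < m < p.
  · by_contra hq0
    have hq0 : q = 0 := by nlinarith
    have h0 : (x - m * a) ^ 2 + d * (y - m * b) ^ 2 = 0 := by rw [e₃, hq0, mul_zero]
    have hx : x - m * a = 0 := by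
      nlinarith [sq_nonneg (x - m * a), mul_nonneg (by omega : 0 ≤ d) (sq_nonneg (y - m * b))]
    have hy : y - m * b = 0 := by
      nlinarith [sq_nonneg (x - m * a), sq_nonneg (y - m * b)]
    have hmd : m ∣ p := by
      refine ⟨a ^ 2 + d * b ^ 2, mul_left_cancel₀ hm0 ?_⟩
      rw [← h, sub_eq_zero.mp hx, sub_eq_zero.mp hy]
      ring
    rcases (Int.prime_iff_natAbs_prime.mp hp).eq_one_or_self_of_dvd _
      (Int.natAbs_dvd_natAbs.mpr hmd) with h1 | h1 <;> omega
  · nlinarith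

/-- The residue of `x` modulo `m` of least absolute value. -/
def centredMod (x m : ℤ) : ℤ := (x + m / 2) % m - m / 2

theorem two_mul_abs_centredMod_le (x : ℤ) {m : ℤ} (hm : 0 < m) : 2 * |centredMod x m| ≤ m := by
  have h₁ := Int.emod_nonneg (x + m / 2) hm.ne'
  have h₂ := Int.emod_lt_of_pos (x + m / 2) hm
  unfold centredMod
  rcases abs_cases ((x + m / 2) % m - m / 2) with ⟨h, _⟩ | ⟨h, _⟩ <;> omega

theorem dvd_sub_centredMod (x m : ℤ) : m ∣ x - centredMod x m := by
  have h := Int.emod_add_mul_ediv (x + m / 2) m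
  exact ⟨(x + m / 2) / m, by unfold centredMod; linarith⟩

theorem exists_sq_add_mul_sq {p : ℤ} {d : ℤ} (hp : Prime p) (hd₁ : 1 ≤ d) (hd₂ : d ≤ 2)
    (m : ℕ) : ∀ x y : ℤ, 0 < m → (m : ℤ) < p → x ^ 2 + d * y ^ 2 = m * p →
      ∃ a b : ℤ, a ^ 2 + d * b ^ 2 = p := by
  induction m using Nat.strong_induction_on with
  | _ m ih =>
    intro x y hm hmp h
    rcases eq_or_ne m 1 with rfl | hm1
    · exact ⟨x, y, by simpa using h⟩
    · have hm0 : (0 : ℤ) < m := by exact_mod_cast hm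
      obtain ⟨h₁, h₂, h₃⟩ := descent_step hp hd₁ hd₂ h (by omega) hmp
        (dvd_sub_centredMod x m) (dvd_sub_centredMod y m) (two_mul_abs_centredMod_le x hm0)
        (two_mul_abs_centredMod_le y hm0)
      generalize (centredMod x m ^ 2 + d * centredMod y m ^ 2) / (m : ℤ) = m' at h₁ h₂ h₃
      lift m' to ℕ using h₂.le
      exact ih m' (by omega) _ _ (by omega) (by omega) h₁

theorem Compatible.exists_sq_add_mul_sq {p : ℕ} {d : ℤ} (h : Compatible p d) :
    ∃ a b : ℤ, a ^ 2 + d * b ^ 2 = p := by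
  have hp : (0 : ℤ) < p := by exact_mod_cast h.1.pos
  have hd : 1 ≤ d ∧ d ≤ 2 := by rcases h.2 with h | h <;> omega
  have hp2 : (3 : ℤ) ≤ p := by rcases h.2 with h | h <;> omega
  have : NeZero p := ⟨h.1.ne_zero⟩
  set z : ZMod p := ((6 - 4 * d : ℤ) : ZMod p) ^ (p / 4 + (d - 1).toNat) with hz
  have hu := h.dvd_sq_add (u := z.val) (by simp [hz])
  have hlt : (z.val : ℤ) < p := by exact_mod_cast z.val_lt
  obtain ⟨m, hm⟩ := hu
  have hm0 : 0 < m := by nlinarith [sq_nonneg (z.val : ℤ)]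
  have hmp : m < p := by nlinarith
  lift m to ℕ using hm0.le
  exact IdealSVP.exists_sq_add_mul_sq (Nat.prime_iff_prime_int.mp h.1) hd.1 hd.2 m z.val 1
    (by omega) hmp (by linarith)

/-- The induction starts with p² ≡ 9 modulo 16; each squaring then adds exactly one factor 2 to the
difference from 1. -/
theorem exists_pow_two_pow_eq {p : ℕ} (h : p % 8 = 3 ∨ p % 8 = 5) (k : ℕ) :
    ∃ q, p ^ 2 ^ (k + 1) = 1 + 2 ^ (k + 3) * (2 * q + 1) := by
  induction k with
  | zero =>
    have h₁ : ∃ q, p = 8 * q + 3 ∨ p = 8 * q + 5 := ⟨p / 8, by omega⟩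
    obtain ⟨q, rfl | rfl⟩ := h₁
    · exact ⟨4 * q ^ 2 + 3 * q, by ring⟩
    · exact ⟨4 * q ^ 2 + 5 * q + 1, by ring⟩
  | succ k ih =>
    obtain ⟨q, hq⟩ := ih
    refine ⟨q + 2 ^ (k + 1) * (2 * q + 1) ^ 2, ?_⟩
    rw [pow_succ 2 (k + 1), pow_mul, hq]
    ring

/-- The order of `p` modulo `2^(n+1)` is at least `2^(n-1)`. -/
theorem Compatible.le_orderOf {p : ℕ} {d : ℤ} (h : Compatible p d) {n : ℕ} (hn : 1 ≤ n)
    (u : (ZMod (2 ^ (n + 1)))ˣ) (hu : (u : ZMod (2 ^ (n + 1))) = p) :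
    2 ^ (n - 1) ≤ orderOf u := by
  have hpm : p % 8 = 3 ∨ p % 8 = 5 := by rcases h.2 with h | h <;> omega
  have hcard : orderOf u ∣ 2 ^ n := by
    have := orderOf_dvd_card (x := u)
    rwa [ZMod.card_units_eq_totient, Nat.totient_prime_pow_succ Nat.prime_two, Nat.add_one_sub_one,
      mul_one] at this
  obtain ⟨k, hk, hok⟩ := (Nat.dvd_prime_pow Nat.prime_two).mp hcard
  rw [hok]
  refine Nat.pow_le_pow_right (by norm_num) ?_
  -- With n = l + 2, a smaller order would give p^(2^l) ≡ 1 modulo 2^(l+3). For l = 0 this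
  -- contradicts p ≡ ±3 modulo 8; for l > 0 the difference is divisible by 2^(l+2) exactly.
  by_contra! hlt
  obtain ⟨l, rfl⟩ : ∃ l, n = l + 2 := ⟨n - 2, by omega⟩
  have h1 : u ^ 2 ^ l = 1 := orderOf_dvd_iff_pow_eq_one.mp (hok ▸ pow_dvd_pow 2 (by omega))
  have h2 : ((p ^ 2 ^ l : ℕ) : ZMod (2 ^ (l + 2 + 1))) = (1 : ℕ) := by
    rw [Nat.cast_pow, ← hu, ← Units.val_pow_eq_pow_val, h1]
    simp
  rw [ZMod.natCast_eq_natCast_iff] at h2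
  rcases l with _ | l
  · have : p % 8 = 1 % 8 := by simpa [Nat.ModEq] using h2
    omega
  · obtain ⟨q, hq⟩ := exists_pow_two_pow_eq hpm l
    rw [hq] at h2
    have h3 := (Nat.modEq_iff_dvd' (by omega)).mp h2.symm
    rw [Nat.add_sub_cancel_left, show l + 1 + 2 + 1 = l + 3 + 1 by ring, pow_succ] at h3
    have := Nat.dvd_of_mul_dvd_mul_left (by positivity) h3
    omega

end IdealSVP

namespace IdealSVP

open Polynomial

/-! ### The ring `ℤ[x]/(x^N + 1)` and its coefficient form -/

variable {n : ℕ}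

theorem natDegree_cycPoly (n : ℕ) : (cycPoly n).natDegree = 2 ^ n := by
  simpa using natDegree_X_pow_add_C (R := ℤ) (n := 2 ^ n) (r := 1)

theorem coeff_cycPoly (n m : ℕ) :
    (cycPoly n).coeff m = (if m = 2 ^ n then 1 else 0) + if m = 0 then 1 else 0 := by
  simp [cycPoly, coeff_X_pow, coeff_one]

/-- The class of `x`. -/
noncomputable abbrev xi (n : ℕ) : CycRing n := AdjoinRoot.root (cycPoly n)

theorem xi_pow (n : ℕ) : xi n ^ 2 ^ n = -1 := by
  have h := AdjoinRoot.mk_self (f := cycPoly n)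
  rw [cycPoly, map_add, map_pow, AdjoinRoot.mk_X, map_one] at h
  exact eq_neg_of_add_eq_zero_left h

/-- The coefficient of `x^j`, extended antiperiodically to all integers `j`. -/
noncomputable def coeffAt (j : ℤ) : CycRing n →+ ℤ where
  toFun a := (j / 2 ^ n).negOnePow *
    (AdjoinRoot.modByMonicHom (cycPoly_monic n) a).coeff (j % 2 ^ n).toNat
  map_zero' := by simp
  map_add' a b := by simp [mul_add]

theorem coeffAt_of_lt (a : CycRing n) {i : ℕ} (hi : i < 2 ^ n) :
    coeffAt (i : ℤ) a = (AdjoinRoot.modByMonicHom (cycPoly_monic n) a).coeff i := by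
  have h : (i : ℤ) < 2 ^ n := by exact_mod_cast hi
  simp [coeffAt, Int.ediv_eq_zero_of_lt (by omega : (0 : ℤ) ≤ i) h,
    Int.emod_eq_of_lt (by omega : (0 : ℤ) ≤ i) h]

theorem coeffAt_add_period (j : ℤ) (a : CycRing n) :
    coeffAt (j + 2 ^ n) a = -coeffAt j a := by
  have h : (2 : ℤ) ^ n ≠ 0 := by positivity
  simp [coeffAt, Int.add_ediv_of_dvd_right, h, Int.negOnePow_succ]

theorem coeffAt_eq_of_natCast {f g : ℤ → ℤ} (hf : ∀ j, f (j + 2 ^ n) = -f j)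
    (hg : ∀ j, g (j + 2 ^ n) = -g j) (h : ∀ i : ℕ, i < 2 ^ n → f i = g i) (j : ℤ) :
    f j = g j := by
  have key : ∀ (k : ℤ) (i : ℕ), i < 2 ^ n → f (i + k * 2 ^ n) = g (i + k * 2 ^ n) := by
    intro k i hi
    induction k with
    | zero => simpa using h i hi
    | succ k ih => rw [add_mul, one_mul, ← add_assoc, hf, hg, ih]
    | pred k ih =>
      have h₁ := hf (i + (-k - 1) * 2 ^ n)
      have h₂ := hg (i + (-k - 1) * 2 ^ n)
      rw [show (i : ℤ) + (-k - 1) * 2 ^ n + 2 ^ n = i + -k * 2 ^ n by ring] at h₁ h₂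
      linarith
  have hpos : (0 : ℤ) < 2 ^ n := by positivity
  have h₁ := Int.emod_nonneg j hpos.ne'
  have h₂ := Int.emod_lt_of_pos j hpos
  have h₃ := key (j / 2 ^ n) (j % 2 ^ n).toNat (by
    zify
    rwa [Int.toNat_of_nonneg h₁])
  rwa [Int.toNat_of_nonneg h₁, Int.emod_add_ediv_mul] at h₃

theorem degree_modByMonicHom_lt (a : CycRing n) :
    (AdjoinRoot.modByMonicHom (cycPoly_monic n) a).degree < (cycPoly n).degree := by
  induction a using AdjoinRoot.induction_on with
  | ih f =>
    rw [AdjoinRoot.modByMonicHom_mk]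
    exact degree_modByMonic_lt _ (cycPoly_monic n)

theorem degree_cycPoly (n : ℕ) : (cycPoly n).degree = (2 ^ n : ℕ) := by
  rw [degree_eq_natDegree (cycPoly_monic n).ne_zero, natDegree_cycPoly]

theorem modByMonicHom_mk_of_degree_lt {f : ℤ[X]} (hf : f.degree < (2 ^ n : ℕ)) :
    AdjoinRoot.modByMonicHom (cycPoly_monic n) (AdjoinRoot.mk (cycPoly n) f) = f := by
  rw [AdjoinRoot.modByMonicHom_mk, modByMonic_eq_self_iff (cycPoly_monic n), degree_cycPoly]
  exact hf

/-- The antiperiodic extension absorbs the sign in x^N = -1, so multiplication by x becomes a pure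
shift. -/
theorem coeffAt_xi_mul (j : ℤ) (a : CycRing n) : coeffAt j (xi n * a) = coeffAt (j - 1) a := by
  refine coeffAt_eq_of_natCast (f := fun j => coeffAt j (xi n * a))
    (g := fun j => coeffAt (j - 1) a) (fun j => coeffAt_add_period _ _)
    (fun j => by rw [add_sub_right_comm, coeffAt_add_period]) (fun i hi => ?_) j
  obtain ⟨M, hM⟩ : ∃ M, 2 ^ n = M + 1 := ⟨2 ^ n - 1, by have := Nat.one_le_two_pow (n := n); omega⟩
  set f := AdjoinRoot.modByMonicHom (cycPoly_monic n) a with hf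
  have ha : a = AdjoinRoot.mk (cycPoly n) f := (AdjoinRoot.mk_leftInverse (cycPoly_monic n) a).symm
  have hdeg : f.degree < (M + 1 : ℕ) := by
    rw [← hM, ← degree_cycPoly]; exact degree_modByMonicHom_lt a
  -- Subtracting the leading coefficient of `f` times x^N + 1 cancels the only term of degree N.
  have hmod : AdjoinRoot.modByMonicHom (cycPoly_monic n) (xi n * a) =
      X * f - C (f.coeff M) * cycPoly n := by
    have hxa : xi n * a = AdjoinRoot.mk (cycPoly n) (X * f - C (f.coeff M) * cycPoly n) := by
      rw [map_sub, map_mul, map_mul, AdjoinRoot.mk_X, AdjoinRoot.mk_self, mul_zero, sub_zero, ← ha]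
    rw [hxa, modByMonicHom_mk_of_degree_lt]
    · rw [degree_lt_iff_coeff_zero]
      intro m hm
      obtain ⟨m, rfl⟩ : ∃ l, m = l + 1 := ⟨m - 1, by omega⟩
      rw [coeff_sub, coeff_X_mul, coeff_C_mul, coeff_cycPoly,
        if_neg (by omega : m + 1 ≠ 0), add_zero, hM]
      split_ifs with h
      · obtain rfl : m = M := by omega
        ring
      · rw [(degree_lt_iff_coeff_zero _ _).mp hdeg m (by omega)]
        ring
  change coeffAt (i : ℤ) (xi n * a) = coeffAt ((i : ℤ) - 1) a
  rw [coeffAt_of_lt _ hi, hmod]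
  rcases i with _ | i
  · have h₁ := coeffAt_add_period (-1) a
    have h₂ : (-1 : ℤ) + 2 ^ n = (M : ℕ) := by
      have : ((2 ^ n : ℕ) : ℤ) = M + 1 := by exact_mod_cast hM
      push_cast at this
      omega
    rw [h₂, coeffAt_of_lt _ (by omega), ← hf] at h₁
    rw [coeff_sub, coeff_C_mul, coeff_X_mul_zero, coeff_cycPoly, hM]
    simp [h₁]
  · rw [coeff_sub, coeff_C_mul, coeff_X_mul, coeff_cycPoly, if_neg (by omega),
      if_neg (by omega)]
    push_cast
    rw [add_sub_cancel_right, coeffAt_of_lt _ (by omega)]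
    simp [hf]

theorem coeffAt_xi_pow_mul (j : ℤ) (k : ℕ) (a : CycRing n) :
    coeffAt j (xi n ^ k * a) = coeffAt (j - k) a := by
  induction k generalizing j with
  | zero => simp
  | succ k ih =>
    rw [pow_succ', mul_assoc, coeffAt_xi_mul, ih]
    push_cast
    ring_nf

theorem coeffAt_intCast_mul (j m : ℤ) (a : CycRing n) :
    coeffAt j ((m : CycRing n) * a) = m * coeffAt j a := by
  rw [← zsmul_eq_mul, map_zsmul, smul_eq_mul]

theorem ofCoeffs_eq_sum (g : Fin (2 ^ n) → ℤ) :
    ofCoeffs n g = ∑ i, (g i : CycRing n) * xi n ^ (i : ℕ) := by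
  simp [ofCoeffs]

theorem coeffAt_ofCoeffs (g : Fin (2 ^ n) → ℤ) (i : Fin (2 ^ n)) :
    coeffAt ((i : ℕ) : ℤ) (ofCoeffs n g) = g i := by
  rw [coeffAt_of_lt _ i.2, ofCoeffs, modByMonicHom_mk_of_degree_lt]
  · rw [finsetSum_coeff]
    simp [coeff_X_pow, Fin.val_inj]
  · exact degree_sum_fin_lt _

theorem ofCoeffs_coeffAt (a : CycRing n) :
    ofCoeffs n (fun i => coeffAt ((i : ℕ) : ℤ) a) = a := by
  conv_rhs => rw [← AdjoinRoot.mk_leftInverse (cycPoly_monic n) a]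
  rw [ofCoeffs]
  congr 1
  ext m
  rw [finsetSum_coeff]
  simp only [coeff_C_mul, coeff_X_pow, mul_ite, mul_one, mul_zero]
  by_cases hm : m < 2 ^ n
  · rw [Finset.sum_eq_single (⟨m, hm⟩ : Fin (2 ^ n))]
    · simp [coeffAt_of_lt _ hm]
    · intro b _ hb
      rw [if_neg]
      rintro rfl
      exact hb rfl
    · simp
  · rw [Finset.sum_eq_zero]
    · symm
      have := degree_modByMonicHom_lt a
      rw [degree_cycPoly] at this
      exact (degree_lt_iff_coeff_zero _ _).mp this m (by omega)
    · intro b _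
      rw [if_neg]
      have := b.2
      omega

theorem coeffEmbedding_ofCoeffs (g : Fin (2 ^ n) → ℤ) :
    coeffEmbedding n (ofCoeffs n g) = toEuclidean g := by
  ext i
  have h := coeffAt_ofCoeffs g i
  rw [coeffAt_of_lt _ i.2] at h
  simp [coeffEmbedding, toEuclidean, h]

theorem natCast_dvd_iff (m : ℕ) (a : CycRing n) :
    (m : CycRing n) ∣ a ↔ ∀ i : ℕ, i < 2 ^ n → (m : ℤ) ∣ coeffAt (i : ℤ) a := by
  constructor
  · rintro ⟨b, rfl⟩ i _
    exact ⟨_, by rw [← coeffAt_intCast_mul, Int.cast_natCast]⟩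
  · intro h
    rw [← ofCoeffs_coeffAt a, ofCoeffs_eq_sum]
    refine Finset.dvd_sum fun i _ => Dvd.dvd.mul_right ?_ _
    obtain ⟨c, hc⟩ := h i i.2
    rw [hc]
    exact ⟨c, by push_cast; rfl⟩

/-- The scalar product of coefficient vectors. -/
noncomputable def dot (a b : CycRing n) : ℤ :=
  ∑ i ∈ Finset.range (2 ^ n), coeffAt (i : ℤ) a * coeffAt (i : ℤ) b

theorem dot_comm (a b : CycRing n) : dot a b = dot b a := by
  simp [dot, mul_comm]

theorem dot_add_left (a b c : CycRing n) : dot (a + b) c = dot a c + dot b c := by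
  simp [dot, add_mul, Finset.sum_add_distrib]

theorem dot_add_right (a b c : CycRing n) : dot a (b + c) = dot a b + dot a c := by
  simp [dot, mul_add, Finset.sum_add_distrib]

theorem dot_intCast_mul_left (m : ℤ) (a b : CycRing n) :
    dot ((m : CycRing n) * a) b = m * dot a b := by
  simp only [dot, Finset.mul_sum, coeffAt_intCast_mul, mul_assoc]

theorem dot_intCast_mul_right (m : ℤ) (a b : CycRing n) :
    dot a ((m : CycRing n) * b) = m * dot a b := by
  rw [dot_comm, dot_intCast_mul_left, dot_comm]

/-- Multiplication by x shifts the coordinates cyclically and flips one sign; this isometry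
underlies all the metric identities below. -/
theorem dot_xi_mul (a b : CycRing n) : dot (xi n * a) (xi n * b) = dot a b := by
  obtain ⟨M, hM⟩ : ∃ M, 2 ^ n = M + 1 := ⟨2 ^ n - 1, by have := Nat.one_le_two_pow (n := n); omega⟩
  simp only [dot, coeffAt_xi_mul]
  rw [hM, Finset.sum_range_succ', Finset.sum_range_succ]
  have h₁ : (M : ℤ) = -1 + 2 ^ n := by
    have : ((2 ^ n : ℕ) : ℤ) = M + 1 := by exact_mod_cast hM
    push_cast at this
    omega
  rw [h₁, coeffAt_add_period, coeffAt_add_period]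
  simp

theorem dot_xi_pow_mul (k : ℕ) (a b : CycRing n) :
    dot (xi n ^ k * a) (xi n ^ k * b) = dot a b := by
  induction k with
  | zero => simp
  | succ k ih => rw [pow_succ', mul_assoc, mul_assoc, dot_xi_mul, ih]

theorem norm_sq_coeffEmbedding (a : CycRing n) : ‖coeffEmbedding n a‖ ^ 2 = (dot a a : ℤ) := by
  rw [EuclideanSpace.norm_sq_eq, dot, ← Fin.sum_univ_eq_sum_range
    (fun i => coeffAt (i : ℤ) a * coeffAt (i : ℤ) a)]
  push_cast
  refine Finset.sum_congr rfl fun i _ => ?_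
  rw [coeffAt_of_lt _ i.2]
  simp [coeffEmbedding, toEuclidean, sq]

theorem one_le_dot_self {a : CycRing n} (ha : a ≠ 0) : 1 ≤ dot a a := by
  by_contra! h
  have h₀ : ∀ i ∈ Finset.range (2 ^ n), 0 ≤ coeffAt (i : ℤ) a * coeffAt (i : ℤ) a :=
    fun i _ => mul_self_nonneg _
  have h₁ : dot a a = 0 := le_antisymm (by omega) (Finset.sum_nonneg h₀)
  rw [dot, Finset.sum_eq_zero_iff_of_nonneg h₀] at h₁
  apply ha
  rw [← ofCoeffs_coeffAt a, ofCoeffs_eq_sum]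
  refine Finset.sum_eq_zero fun i _ => ?_
  rw [mul_self_eq_zero.mp (h₁ i (Finset.mem_range.mpr i.2)), Int.cast_zero, zero_mul]

theorem dot_self_zero : dot (0 : CycRing n) 0 = 0 := by
  simp [dot]

/-- A nonzero element of least norm gives a shortest vector. -/
theorem isShortestVector_coeffEmbedding {I : Ideal (CycRing n)} {a : CycRing n} (ha : a ∈ I)
    (ha₀ : a ≠ 0) (h : ∀ b ∈ I, b ≠ 0 → dot a a ≤ dot b b) :
    IsShortestVector (idealLattice I) (coeffEmbedding n a) := by
  refine ⟨⟨a, ha, rfl⟩, fun h₀ => ?_, ?_⟩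
  · have h₁ := norm_sq_coeffEmbedding a
    rw [h₀, norm_zero] at h₁
    have h₂ := one_le_dot_self ha₀
    have h₃ : ((dot a a : ℤ) : ℝ) = 0 := by rw [← h₁]; norm_num
    rw [Int.cast_eq_zero] at h₃
    omega
  · rintro _ ⟨b, hb, rfl⟩ hb₀
    refine le_of_sq_le_sq ?_ (norm_nonneg _)
    change ‖coeffEmbedding n a‖ ^ 2 ≤ ‖coeffEmbedding n b‖ ^ 2
    rw [norm_sq_coeffEmbedding, norm_sq_coeffEmbedding, Int.cast_le]
    refine h b hb ?_
    rintro rfl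
    exact hb₀ (map_zero _)

end IdealSVP

namespace IdealSVP

open Polynomial

/-! ### Prime ideals above `p` -/

section Residue

variable {n p : ℕ} {d : ℤ} {𝔭 : Ideal (CycRing n)}

/-- The degree of the residue field: no polynomial of degree less than `N / 2` that is nonzero
modulo `p` vanishes at `x` modulo a prime ideal above `p`. -/
theorem Compatible.dvd_of_mem (h : Compatible p d) (hn : 1 ≤ n) [h𝔭 : 𝔭.IsPrime]
    (hp𝔭 : (p : CycRing n) ∈ 𝔭) {r : ℤ[X]} (hr : r.degree < (2 ^ (n - 1) : ℕ))
    (hmem : AdjoinRoot.mk (cycPoly n) r ∈ 𝔭) : C (p : ℤ) ∣ r := by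
  have hp := h.1
  have : Fact p.Prime := ⟨hp⟩
  let k := CycRing n ⧸ 𝔭
  let φ : CycRing n →+* k := Ideal.Quotient.mk 𝔭
  have hpk : (p : k) = 0 := by
    rw [← map_natCast φ, Ideal.Quotient.eq_zero_iff_mem.mpr hp𝔭]
  have : CharP k p := (CharP.charP_iff_prime_eq_zero hp).mpr hpk
  let : Algebra (ZMod p) k := ZMod.algebra k p
  set ζ : k := φ (xi n) with hζ
  have hζN : ζ ^ 2 ^ n = -1 := by rw [hζ, ← map_pow, xi_pow, map_neg, map_one]
  have hcyc : (cyclotomic (2 ^ (n + 1)) (ZMod p)) = X ^ 2 ^ n + 1 := by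
    rw [cyclotomic_prime_pow_eq_geom_sum Nat.prime_two]
    simp [Finset.sum_range_succ, add_comm]
  have hroot : aeval ζ (cyclotomic (2 ^ (n + 1)) (ZMod p)) = 0 := by
    rw [hcyc]
    simp [hζN]
  have hint : IsIntegral (ZMod p) ζ := ⟨_, cyclotomic.monic _ _, hroot⟩
  have hodd : p % 2 = 1 := by rcases h.2 with h | h <;> omega
  have hcop : p.Coprime (2 ^ (n + 1)) :=
    (Nat.coprime_two_right.mpr (Nat.odd_iff.mpr hodd)).pow_right _
  -- The minimal polynomial of ζ is an irreducible factor of the cyclotomic polynomial Φ_(2N) over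
  -- 𝔽_p, so its degree is the order of p modulo 2N.
  have hdeg : 2 ^ (n - 1) ≤ (minpoly (ZMod p) ζ).natDegree := by
    have hcard : Fintype.card (ZMod p) = p ^ 1 := by simp
    rw [natDegree_of_dvd_cyclotomic_of_irreducible hcard hcop (minpoly.dvd _ _ hroot)
      (minpoly.irreducible hint)]
    exact h.le_orderOf hn _ (by simp)
  have hzero : r.map (Int.castRingHom (ZMod p)) = 0 := by
    by_contra hne
    have hvan : aeval ζ (r.map (Int.castRingHom (ZMod p))) = 0 := by
      have h₁ : φ (AdjoinRoot.mk (cycPoly n) r) = 0 := Ideal.Quotient.eq_zero_iff_mem.mpr hmem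
      have h₂ : (aeval ζ).toRingHom.comp (mapRingHom (Int.castRingHom (ZMod p))) =
          φ.comp (AdjoinRoot.mk (cycPoly n)) := by
        refine ringHom_ext (fun m => ?_) ?_
        · simp
        · simp [hζ]
      exact (RingHom.congr_fun h₂ r).trans h₁
    have h₁ := natDegree_le_of_dvd (minpoly.dvd _ _ hvan) hne
    have h₂ := (natDegree_map_le (f := Int.castRingHom (ZMod p)) (p := r))
    have hr0 : r ≠ 0 := by rintro rfl; simp at hne
    have h₃ := (natDegree_lt_iff_degree_lt hr0).mpr hr
    omega
  rw [C_dvd_iff_dvd_coeff]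
  intro i
  have h₁ := congrArg (fun q => q.coeff i) hzero
  simp only [coeff_map, coeff_zero, eq_intCast] at h₁
  exact (ZMod.intCast_zmod_eq_zero_iff_dvd _ _).mp h₁

/-- A rational integer in a prime ideal above `p` is divisible by `p`. -/
theorem intCast_dvd_of_mem (hp : p.Prime) (h𝔭 : 𝔭.IsPrime) (hp𝔭 : (p : CycRing n) ∈ 𝔭) {m : ℤ}
    (hm : (m : CycRing n) ∈ 𝔭) : (p : ℤ) ∣ m := by
  by_contra hd
  obtain ⟨a, b, hab⟩ := ((Nat.prime_iff_prime_int.mp hp).irreducible.coprime_iff_not_dvd.mpr hd)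
  refine h𝔭.ne_top ((Ideal.eq_top_iff_one _).mpr ?_)
  have h₁ : (1 : CycRing n) = a * (p : CycRing n) + b * m := by
    rw [← Int.cast_one, ← hab]
    push_cast
    rfl
  rw [h₁]
  exact 𝔭.add_mem (𝔭.mul_mem_left _ hp𝔭) (𝔭.mul_mem_left _ hm)

end Residue

/-! ### The elements `a + b s` with `s² = -d` -/

/-- The element `s = y + (d - 1) y³`, where `y = x^K`. -/
noncomputable def skew (n K : ℕ) (d : ℤ) : CycRing n :=
  xi n ^ K + (d - 1) * xi n ^ (3 * K)

theorem skew_one (n K : ℕ) : skew n K 1 = xi n ^ K := by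
  simp [skew]

theorem skew_two (n K : ℕ) : skew n K 2 = xi n ^ K + xi n ^ (3 * K) := by
  unfold skew
  push_cast
  ring

/-- The element `a + b s`, where `s = y + (d - 1) y³` and `y = x^K`. -/
noncomputable def gen (n K : ℕ) (d a b : ℤ) : CycRing n :=
  a + b * skew n K d

/-- The exponent `K` with `2 d K = N`. -/
def IsStep (n K : ℕ) (d : ℤ) : Prop :=
  d = 1 ∧ 2 * K = 2 ^ n ∨ d = 2 ∧ 4 * K = 2 ^ n

section Gen

variable {n K : ℕ} {d : ℤ}

theorem dot_one : dot (1 : CycRing n) 1 = 1 := by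
  have hz : ∀ i : Fin (2 ^ n), coeffAt ((i : ℕ) : ℤ) (1 : CycRing n) =
      if (i : ℕ) = 0 then 1 else 0 := by
    intro i
    have hdeg : (1 : ℤ[X]).degree < (2 ^ n : ℕ) := by
      rw [degree_one]
      exact_mod_cast Nat.two_pow_pos n
    rw [coeffAt_of_lt _ i.2, ← map_one (AdjoinRoot.mk (cycPoly n)),
      modByMonicHom_mk_of_degree_lt hdeg, coeff_one]
  rw [dot, Finset.sum_eq_single 0]
  · have := hz ⟨0, Nat.two_pow_pos n⟩
    simp only [if_true] at this
    rw [this, one_mul]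
  · intro i hi hi0
    have := hz ⟨i, Finset.mem_range.mp hi⟩
    simp only [if_neg hi0] at this
    rw [this, zero_mul]
  · intro h
    exact absurd (Finset.mem_range.mpr (Nat.two_pow_pos n)) h

/-- With y = x^K one has y² = -1 for d = 1. For d = 2 one has y⁴ = -1, and (y + y³)² = y²(1 + y⁴) +
2y⁴ = -2. -/
theorem IsStep.skew_sq (h : IsStep n K d) : skew n K d ^ 2 = -d := by
  have hx := xi_pow n
  rcases h with ⟨rfl, h⟩ | ⟨rfl, h⟩ <;> rw [← h] at hx
  · rw [skew_one]
    push_cast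
    linear_combination hx
  · rw [skew_two]
    push_cast
    linear_combination (xi n ^ (2 * K) + 2) * hx

theorem IsStep.gen_mul_gen (h : IsStep n K d) (a b : ℤ) :
    gen n K d a b * gen n K d a (-b) = ((a ^ 2 + d * b ^ 2 : ℤ) : CycRing n) := by
  unfold gen
  push_cast
  linear_combination (-(b : CycRing n) ^ 2) * h.skew_sq

/-- The isometry y has inverse -y for d = 1 and -y³ for d = 2. So s is y, respectively y - y⁻¹, and
is skew-adjoint. -/
theorem IsStep.dot_skew (h : IsStep n K d) (w : CycRing n) : dot w (skew n K d * w) = 0 := by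
  have hx := xi_pow n
  have hneg : ∀ a b : CycRing n, dot a (-b) = -dot a b := fun a b => by
    simpa using dot_intCast_mul_right (-1) a b
  rcases h with ⟨rfl, h⟩ | ⟨rfl, h⟩ <;> rw [← h] at hx
  · have h₁ := dot_xi_pow_mul K w (xi n ^ K * w)
    rw [← mul_assoc, ← pow_add, ← two_mul, hx, neg_one_mul, hneg, dot_comm] at h₁
    rw [skew_one]
    omega
  · have h₁ := dot_xi_pow_mul K w (xi n ^ (3 * K) * w)
    rw [← mul_assoc, ← pow_add, show K + 3 * K = 4 * K by ring, hx, neg_one_mul, hneg,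
      dot_comm] at h₁
    rw [skew_two, add_mul, dot_add_right]
    omega

/-- For d = 2 the vectors y w and y³ w are orthogonal, since the isometry y² sends the first to the
second and the second to minus the first. Both have the length of w. -/
theorem IsStep.dot_mul_self (h : IsStep n K d) (w : CycRing n) :
    dot (skew n K d * w) (skew n K d * w) = d * dot w w := by
  have hx := xi_pow n
  have hneg : ∀ a b : CycRing n, dot a (-b) = -dot a b := fun a b => by
    simpa using dot_intCast_mul_right (-1) a b
  rcases h with ⟨rfl, h⟩ | ⟨rfl, h⟩ <;> rw [← h] at hx
  · rw [skew_one, dot_xi_pow_mul, one_mul]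
  · have h₁ := dot_xi_pow_mul (2 * K) (xi n ^ K * w) (xi n ^ (3 * K) * w)
    have h₃ : xi n ^ (2 * K) * (xi n ^ (3 * K) * w) = -(xi n ^ K * w) := by
      linear_combination (xi n ^ K * w) * hx
    have h₄ : xi n ^ (2 * K) * (xi n ^ K * w) = xi n ^ (3 * K) * w := by ring
    rw [h₃, h₄, hneg, dot_comm (xi n ^ (3 * K) * w)] at h₁
    rw [skew_two, add_mul, dot_add_left, dot_add_right, dot_add_right, dot_xi_pow_mul,
      dot_xi_pow_mul, dot_comm (xi n ^ (3 * K) * w)]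
    omega

/-- The key identity: w and s w are orthogonal and |s w|² = d |w|², so multiplication by a + b s is
a similarity. -/
theorem IsStep.dot_gen_mul (h : IsStep n K d) (a b : ℤ) (w : CycRing n) :
    dot (gen n K d a b * w) (gen n K d a b * w) = (a ^ 2 + d * b ^ 2) * dot w w := by
  unfold gen
  rw [add_mul, mul_assoc]
  simp only [dot_add_left, dot_add_right, dot_intCast_mul_left, dot_intCast_mul_right]
  rw [h.dot_mul_self, dot_comm (skew n K d * w) w, h.dot_skew]
  ring

theorem coeffAt_gen_mul (j : ℤ) (a b : ℤ) (w : CycRing n) :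
    coeffAt j (gen n K d a b * w) = a * coeffAt j w +
      b * (coeffAt (j - K) w + (d - 1) * coeffAt (j - 3 * K) w) := by
  have : gen n K d a b * w = (a : CycRing n) * w + (b : CycRing n) * (xi n ^ K * w) +
      ((b * (d - 1) : ℤ) : CycRing n) * (xi n ^ (3 * K) * w) := by
    unfold gen skew; push_cast; ring
  rw [this, map_add, map_add, coeffAt_intCast_mul, coeffAt_intCast_mul, coeffAt_intCast_mul,
    coeffAt_xi_pow_mul, coeffAt_xi_pow_mul]
  push_cast
  ring

/-- For d = 1 the index 3K exceeds N and the hypothesis there only says that v vanishes, so the two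
cases share one form. -/
theorem IsStep.ofCoeffs_eq_gen (h : IsStep n K d) {a b : ℤ} {v : ℤ → ℤ} (h0 : v 0 = a)
    (hK : v K = b) (h3K : v (3 * K) = (d - 1) * b)
    (hv : ∀ j, j ≠ 0 → j ≠ K → j ≠ 3 * K → v j = 0) :
    ofCoeffs n (fun i => v ((i : ℕ) : ℤ)) = gen n K d a b := by
  have hpos : 0 < 2 ^ n := Nat.two_pow_pos n
  have hKN : 0 < K ∧ K < 2 ^ n := by rcases h with h | h <;> omega
  rw [ofCoeffs_eq_sum, Fin.sum_univ_eq_sum_range (fun i => (v (i : ℤ) : CycRing n) * xi n ^ i)]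
  have hterm : ∀ i ∈ Finset.range (2 ^ n), (v (i : ℤ) : CycRing n) * xi n ^ i =
      (if i = 0 then (a : CycRing n) else 0) + (if i = K then (b : CycRing n) * xi n ^ K else 0) +
        (if i = 3 * K then (((d - 1) * b : ℤ) : CycRing n) * xi n ^ (3 * K) else 0) := by
    intro i _
    by_cases h₀ : i = 0
    · subst h₀
      rw [if_pos rfl, if_neg (by omega), if_neg (by omega)]
      simp [h0]
    by_cases h₁ : i = K
    · subst h₁
      rw [if_neg h₀, if_pos rfl, if_neg (by omega), hK]
      simp
    by_cases h₂ : i = 3 * K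
    · subst h₂
      rw [if_neg h₀, if_neg h₁, if_pos rfl]
      push_cast [h3K]
      simp
    · rw [if_neg h₀, if_neg h₁, if_neg h₂, hv i (by omega) (by omega) (by omega)]
      simp
  rw [Finset.sum_congr rfl hterm, Finset.sum_add_distrib, Finset.sum_add_distrib,
    Finset.sum_ite_eq', Finset.sum_ite_eq', Finset.sum_ite_eq', if_pos (by simp),
    if_pos (by simpa using hKN.2)]
  unfold gen skew
  rcases h with ⟨rfl, h⟩ | ⟨rfl, h⟩
  · simp
  · rw [if_pos (by rw [Finset.mem_range]; omega)]
    push_cast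
    ring

/-! ### Generators of the prime ideals above p and the sign test -/

variable {p : ℕ} {𝔭 : Ideal (CycRing n)} {a b : ℤ}

theorem IsStep.gen_dvd_natCast (h : IsStep n K d) (hab : a ^ 2 + d * b ^ 2 = p) :
    gen n K d a b ∣ (p : CycRing n) :=
  ⟨gen n K d a (-b), by rw [h.gen_mul_gen, hab, Int.cast_natCast]⟩

theorem Compatible.isCoprime (hc : Compatible p d) (hab : a ^ 2 + d * b ^ 2 = p) :
    IsCoprime b (p : ℤ) := by
  have hp := Nat.prime_iff_prime_int.mp hc.1
  have hd : 1 ≤ d ∧ d ≤ 2 := by rcases hc.2 with h | h <;> omega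
  rw [isCoprime_comm, hp.irreducible.coprime_iff_not_dvd]
  intro hdvd
  have h1 : (p : ℤ) ∣ a := by
    apply hp.dvd_of_dvd_pow (n := 2)
    rw [show a ^ 2 = p - d * b ^ 2 by linarith]
    exact dvd_sub_self_left.mpr (Dvd.dvd.mul_left (dvd_pow hdvd two_ne_zero) _)
  obtain ⟨a, rfl⟩ := h1
  obtain ⟨b, rfl⟩ := hdvd
  have hp0 : (0 : ℤ) < p := by exact_mod_cast hc.1.pos
  have h2 : (p : ℤ) * (a ^ 2 + d * b ^ 2) = 1 :=
    mul_left_cancel₀ hp0.ne' (by linear_combination hab)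
  have h3 : IsUnit (p : ℤ) := IsUnit.of_mul_eq_one _ h2
  exact hp.not_isUnit h3

/-- A prime ideal above `p` that contains `a + b s` with `a² + d b² = p` is generated by it. -/
theorem Compatible.eq_span_gen (hc : Compatible p d) (hn : 1 ≤ n) (h : IsStep n K d)
    (hab : a ^ 2 + d * b ^ 2 = p) (h𝔭 : 𝔭.IsPrime) (hmem : gen n K d a b ∈ 𝔭) :
    𝔭 = Ideal.span {gen n K d a b} := by
  have hπp := h.gen_dvd_natCast hab
  have hp𝔭 : (p : CycRing n) ∈ 𝔭 := 𝔭.mem_of_dvd hπp hmem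
  refine le_antisymm (fun z hz => ?_) ((Ideal.span_singleton_le_iff_mem _).mpr hmem)
  rw [Ideal.mem_span_singleton]
  -- With b' inverse to b modulo p, the relation a + b s ≡ 0 modulo π becomes s ≡ -a b'.
  obtain ⟨b', q, hbq⟩ := hc.isCoprime hab
  set s := skew n K d with hs
  have hgen : gen n K d a b = a + b * s := rfl
  have hsu : gen n K d a b ∣ s + ((a * b' : ℤ) : CycRing n) := by
    have hbq' : (b' : CycRing n) * b + q * (p : CycRing n) = 1 := by
      exact_mod_cast congrArg (Int.cast : ℤ → CycRing n) hbq
    have : s + ((a * b' : ℤ) : CycRing n) =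
        gen n K d a b * b' + (p : CycRing n) * (q * s) := by
      rw [hgen]
      push_cast
      linear_combination (-s) * hbq'
    rw [this]
    exact dvd_add (dvd_mul_right _ _) (hπp.mul_right _)
  -- A monic equation of degree N/2 for x modulo π. For d = 1 it is s + a b' ≡ 0 itself; for d = 2
  -- that relation is multiplied by x^K, and x^(4K) = -1 leaves x^(2K) + a b' x^K - 1.
  obtain ⟨P, hPm, hPd, hPπ⟩ : ∃ P : ℤ[X], P.Monic ∧ P.degree = (2 ^ (n - 1) : ℕ) ∧
      gen n K d a b ∣ AdjoinRoot.mk (cycPoly n) P := by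
    have hx := xi_pow n
    have hpow : 2 ^ n = 2 * 2 ^ (n - 1) := by
      obtain ⟨l, rfl⟩ : ∃ l, n = l + 1 := ⟨n - 1, by omega⟩
      rw [pow_succ', Nat.add_sub_cancel]
    have hpos : 0 < 2 ^ (n - 1) := Nat.two_pow_pos _
    rcases h with ⟨rfl, h⟩ | ⟨rfl, h⟩
    · refine ⟨X ^ 2 ^ (n - 1) + C (a * b'), monic_X_pow_add_C _ hpos.ne',
        degree_X_pow_add_C hpos _, ?_⟩
      have hK : K = 2 ^ (n - 1) := by omega
      convert hsu using 1
      rw [map_add, map_pow, AdjoinRoot.mk_X, AdjoinRoot.mk_C, ← hK, hs, skew_one]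
      simp
    · have hK : 2 * K = 2 ^ (n - 1) := by omega
      have hlow : (C (a * b') * X ^ K - 1 : ℤ[X]).degree < (2 ^ (n - 1) : ℕ) := by
        refine (degree_sub_le _ _).trans_lt (max_lt ((degree_C_mul_X_pow_le _ _).trans_lt ?_) ?_)
        · exact_mod_cast (by omega : K < 2 ^ (n - 1))
        · rw [degree_one]
          exact_mod_cast hpos
      refine ⟨X ^ 2 ^ (n - 1) + (C (a * b') * X ^ K - 1), monic_X_pow_add hlow, ?_, ?_⟩
      · rw [degree_add_eq_left_of_degree_lt (by rwa [degree_X_pow]), degree_X_pow]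
      · have : AdjoinRoot.mk (cycPoly n) (X ^ 2 ^ (n - 1) + (C (a * b') * X ^ K - 1)) =
            xi n ^ K * (s + ((a * b' : ℤ) : CycRing n)) := by
          rw [map_add, map_sub, map_mul, map_pow, map_pow, AdjoinRoot.mk_X, AdjoinRoot.mk_C,
            map_one, ← hK, hs, skew_two]
          rw [← h] at hx
          push_cast
          simp only [eq_intCast, Int.cast_mul]
          linear_combination (-1 : CycRing n) * hx
        rw [this]
        exact hsu.mul_left _
  obtain ⟨f, rfl⟩ := AdjoinRoot.mk_surjective z
  have hf : AdjoinRoot.mk (cycPoly n) f = AdjoinRoot.mk (cycPoly n) (f %ₘ P) +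
      AdjoinRoot.mk (cycPoly n) P * AdjoinRoot.mk (cycPoly n) (f /ₘ P) := by
    rw [← map_mul, ← map_add, modByMonic_add_div f P]
  have hPπ' := hPπ.mul_right (AdjoinRoot.mk (cycPoly n) (f /ₘ P))
  have hr : AdjoinRoot.mk (cycPoly n) (f %ₘ P) ∈ 𝔭 := by
    have := 𝔭.sub_mem hz (𝔭.mem_of_dvd hPπ' hmem)
    rwa [hf, add_sub_cancel_right] at this
  -- The remainder modulo P lies in 𝔭 and has degree below N/2, so p divides it, and π divides p.
  have hdvd := hc.dvd_of_mem hn hp𝔭 (hPd ▸ degree_modByMonic_lt f hPm) hr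
  rw [hf]
  refine dvd_add (hπp.trans ?_) hPπ'
  have := map_dvd (AdjoinRoot.mk (cycPoly n)) hdvd
  simpa using this

/-- A prime ideal above `p` contains `a + b s` or `a - b s` whenever `a² + d b² = p`. -/
theorem IsStep.gen_mem_or (h : IsStep n K d) (hab : a ^ 2 + d * b ^ 2 = p) (h𝔭 : 𝔭.IsPrime)
    (hp𝔭 : (p : CycRing n) ∈ 𝔭) : gen n K d a b ∈ 𝔭 ∨ gen n K d a (-b) ∈ 𝔭 := by
  apply h𝔭.mem_or_mem
  rw [h.gen_mul_gen, hab]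
  simpa using hp𝔭

theorem IsStep.dot_gen (h : IsStep n K d) (hab : a ^ 2 + d * b ^ 2 = p) :
    dot (gen n K d a b) (gen n K d a b) = p := by
  have h₁ := h.dot_gen_mul a b 1
  rw [mul_one, dot_one, mul_one, hab] at h₁
  exact h₁

/-- Every element of 𝔭 is π w, of squared length p |w|², and |w|² is a positive integer unless w =
0. -/
theorem Compatible.le_dot (hc : Compatible p d) (hn : 1 ≤ n) (h : IsStep n K d)
    (hab : a ^ 2 + d * b ^ 2 = p) (h𝔭 : 𝔭.IsPrime) (hmem : gen n K d a b ∈ 𝔭) {z : CycRing n}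
    (hz : z ∈ 𝔭) (hz0 : z ≠ 0) : (p : ℤ) ≤ dot z z := by
  rw [hc.eq_span_gen hn h hab h𝔭 hmem, Ideal.mem_span_singleton] at hz
  obtain ⟨w, rfl⟩ := hz
  rw [h.dot_gen_mul, hab]
  have := one_le_dot_self (right_ne_zero_of_mul hz0)
  nlinarith

theorem Compatible.isShortestVector_gen (hc : Compatible p d) (hn : 1 ≤ n) (h : IsStep n K d)
    (hab : a ^ 2 + d * b ^ 2 = p) (h𝔭 : 𝔭.IsPrime) (hmem : gen n K d a b ∈ 𝔭) :
    IsShortestVector (idealLattice 𝔭) (coeffEmbedding n (gen n K d a b)) := by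
  refine isShortestVector_coeffEmbedding hmem ?_ fun z hz hz0 => ?_
  · intro h0
    have := h.dot_gen hab
    rw [h0, dot_self_zero] at this
    exact hc.1.ne_zero (by exact_mod_cast this.symm)
  · rw [h.dot_gen hab]
    exact hc.le_dot hn h hab h𝔭 hmem hz hz0

/-- The sign test: `a + b s` belongs to `𝔭 = (p, g)` if and only if `p` divides `(a - b s) g`. -/
theorem Compatible.gen_mem_iff (hc : Compatible p d) (hn : 1 ≤ n) (h : IsStep n K d)
    (hab : a ^ 2 + d * b ^ 2 = p) (h𝔭 : 𝔭.IsPrime) {g : CycRing n}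
    (hg : 𝔭 = Ideal.span {(p : CycRing n), g}) :
    gen n K d a b ∈ 𝔭 ↔ (p : CycRing n) ∣ gen n K d a (-b) * g := by
  have hπ : gen n K d a b * gen n K d a (-b) = p := by
    rw [h.gen_mul_gen, hab, Int.cast_natCast]
  have hp𝔭 : (p : CycRing n) ∈ 𝔭 := hg ▸ Ideal.subset_span (by simp)
  constructor
  · intro hmem
    have hg𝔭 : g ∈ 𝔭 := hg ▸ Ideal.subset_span (by simp)
    rw [hc.eq_span_gen hn h hab h𝔭 hmem, Ideal.mem_span_singleton] at hg𝔭
    obtain ⟨w, rfl⟩ := hg𝔭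
    exact ⟨w, by rw [← hπ]; ring⟩
  · intro hdvd
    rcases h.gen_mem_or hab h𝔭 hp𝔭 with h₁ | h₁
    · exact h₁
    exfalso
    -- Suppose the conjugate π' = a - b s lies in (p, g). Then π'² is congruent to a multiple of π'
    -- g modulo p, so p ∣ π'².
    rw [hg, Ideal.mem_span_pair] at h₁
    obtain ⟨u, v, huv⟩ := h₁
    have h₂ : (p : CycRing n) ∣ gen n K d a (-b) * gen n K d a (-b) * 1 := by
      have : gen n K d a (-b) * gen n K d a (-b) * 1 =
          p * (u * gen n K d a (-b)) + gen n K d a (-b) * g * v := by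
        nth_rw 2 [← huv]; ring
      rw [this]
      exact dvd_add (dvd_mul_right _ _) (hdvd.mul_right _)
    -- Since π π' = p, also p ∣ (π - π') π' = 2b s π' = 2b (d b + a s).
    have h₃ : (p : CycRing n) ∣ ((2 * b : ℤ) : CycRing n) * (gen n K d (d * b) a * 1) := by
      have h₄ : ((2 * b : ℤ) : CycRing n) * (gen n K d (d * b) a * 1) =
          gen n K d a b * gen n K d a (-b) -
            gen n K d a (-b) * gen n K d a (-b) * 1 := by
        unfold gen
        have hs := h.skew_sq
        push_cast
        linear_combination (2 * b ^ 2 : CycRing n) * hs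
      rw [h₄, hπ]
      exact dvd_sub_self_left.mpr h₂
    obtain ⟨w, hw⟩ := h₃
    -- Comparing squared lengths gives p² |w|² = 4 b² d p, so p ∣ 4 d b². This is impossible, since
    -- p is odd and prime to b.
    have h₄ : dot ((p : ℤ) * w : CycRing n) ((p : ℤ) * w) =
        2 * b * (2 * b * ((d * b) ^ 2 + d * a ^ 2)) := by
      rw [Int.cast_natCast, ← hw, dot_intCast_mul_left, dot_intCast_mul_right, h.dot_gen_mul,
        dot_one, mul_one]
    rw [dot_intCast_mul_left, dot_intCast_mul_right] at h₄
    have hp0 : (p : ℤ) ≠ 0 := by exact_mod_cast hc.1.ne_zero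
    have h₅ : (p : ℤ) * dot w w = b * (b * (4 * d)) :=
      mul_left_cancel₀ hp0 (by linear_combination h₄ + 4 * b ^ 2 * d * hab)
    have hcop := (hc.isCoprime hab).symm
    have h₆ : (p : ℤ) ∣ 4 * d :=
      hcop.dvd_of_dvd_mul_left (hcop.dvd_of_dvd_mul_left ⟨_, h₅.symm⟩)
    have h₇ : (p : ℤ) ∣ 2 ^ 3 := by
      rcases hc.2 with h | h <;> obtain ⟨-, rfl⟩ := h
      · exact h₆
      · exact h₆.trans ⟨2, by norm_num⟩
    have h₈ := (Nat.prime_iff_prime_int.mp hc.1).dvd_of_dvd_pow h₇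
    have h₉ : p ∣ 2 := by exact_mod_cast h₈
    have := Nat.le_of_dvd two_pos h₉
    rcases hc.2 with h | h <;> omega

end Gen

end IdealSVP

namespace IdealSVP

/-! ### The inert case -/

/-- As p ≡ 3 modulo 4, -1 is not a square modulo p. -/
theorem dvd_of_dvd_sq_add_sq {p : ℕ} (hp : p.Prime) (h : p % 8 = 3) {a b : ℤ}
    (hab : (p : ℤ) ∣ a ^ 2 + b ^ 2) : (p : ℤ) ∣ a ∧ (p : ℤ) ∣ b := by
  have : Fact p.Prime := ⟨hp⟩
  have key : ∀ a b : ℤ, (p : ℤ) ∣ a ^ 2 + b ^ 2 → (p : ℤ) ∣ b := by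
    intro a b hab
    by_contra hb
    rw [← ZMod.intCast_zmod_eq_zero_iff_dvd] at hab hb
    push_cast at hab
    have := ZMod.mod_four_ne_three_of_sq_eq_neg_sq' hb (eq_neg_of_add_eq_zero_left hab)
    omega
  exact ⟨key b a (by rwa [add_comm]), key a b hab⟩

/-- In ℤ[i] the norm a² + b² of an element of 𝔭 lies in 𝔭 ∩ ℤ = pℤ, which forces p ∣ a and p ∣ b. So
𝔭 consists of multiples of p. -/
theorem isShortestVector_of_inert {p : ℕ} {𝔭 : Ideal (CycRing 1)} (hp : p.Prime) (h : p % 8 = 3)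
    (h𝔭 : 𝔭.IsPrime) (hp𝔭 : (p : CycRing 1) ∈ 𝔭) :
    IsShortestVector (idealLattice 𝔭) (coeffEmbedding 1 (p : CycRing 1)) := by
  have hp1 : (1 : ℤ) < p := by exact_mod_cast hp.one_lt
  have hpp : dot (p : CycRing 1) (p : CycRing 1) = p * p := by
    have := dot_intCast_mul_left p (1 : CycRing 1) ((p : ℤ) * 1 : CycRing 1)
    rw [dot_intCast_mul_right p 1 1, dot_one] at this
    simpa using this
  have hp0 : (p : CycRing 1) ≠ 0 := by
    intro h0
    rw [h0, dot_self_zero] at hpp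
    nlinarith
  refine isShortestVector_coeffEmbedding hp𝔭 hp0 fun z hz hz0 => ?_
  set a := coeffAt 0 z with ha
  set b := coeffAt 1 z with hb
  have hz' : z = (a : CycRing 1) + b * xi 1 := by
    conv_lhs => rw [← ofCoeffs_coeffAt z, ofCoeffs_eq_sum,
      Fin.sum_univ_eq_sum_range (fun i => (coeffAt (i : ℤ) z : CycRing 1) * xi 1 ^ i)]
    simp [Finset.sum_range_succ, ha, hb]
  have hx := xi_pow 1
  have hmem : ((a ^ 2 + b ^ 2 : ℤ) : CycRing 1) ∈ 𝔭 := by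
    have := 𝔭.mul_mem_left ((a : CycRing 1) - b * xi 1) hz
    rw [hz'] at this
    convert this using 1
    push_cast
    linear_combination (b : CycRing 1) ^ 2 * hx
  obtain ⟨ha', hb'⟩ := dvd_of_dvd_sq_add_sq hp h (intCast_dvd_of_mem hp h𝔭 hp𝔭 hmem)
  have hdvd : (p : CycRing 1) ∣ z := by
    rw [natCast_dvd_iff]
    intro i hi
    have : i = 0 ∨ i = 1 := by omega
    rcases this with rfl | rfl
    · exact ha'
    · exact hb'
  obtain ⟨w, hw⟩ := hdvd
  have h₁ : dot z z = p * (p * dot w w) := by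
    rw [hw, ← Int.cast_natCast, dot_intCast_mul_left, dot_intCast_mul_right]
  have h₂ : 1 ≤ dot w w := one_le_dot_self (by
    rintro rfl
    exact hz0 (by rw [hw, mul_zero]))
  rw [h₁, hpp]
  nlinarith

/-! ### Instances of the problem and a Hoare logic for polynomial time -/

/-- An instance of the shortest vector problem. -/
structure Inst where
  n : ℕ
  p : ℕ
  d : ℤ
  𝔭 : Ideal (CycRing n)
  g : Fin (2 ^ n) → ℤ
  one_le : 1 ≤ n
  compatible : Compatible p d
  isPrime : 𝔭.IsPrime
  abs_lt : ∀ i, |g i| < (p : ℤ)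
  eq_span : 𝔭 = Ideal.span {(p : CycRing n), ofCoeffs n g}

namespace Inst

/-- The size of the input. -/
def size (i : Inst) : ℕ := 2 ^ i.n + Nat.log 2 i.p + 3

/-- A bound for all integers that occur in the computation. -/
def bound (i : Inst) : ℤ := 2 ^ i.n * i.p

/-- The memory in the initial state. -/
def mem (i : Inst) : ℤ → ℤ := (inputState (2 ^ i.n) i.p i.g).mem

variable (i : Inst)

theorem d_cases : i.p % 8 = 3 ∧ i.d = 2 ∨ i.p % 8 = 5 ∧ i.d = 1 := i.compatible.2

theorem three_le : (3 : ℤ) ≤ i.p := by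
  have := i.d_cases
  omega

theorem two_le : (2 : ℤ) ≤ 2 ^ i.n := by
  have := Nat.pow_le_pow_right (n := 2) two_pos i.one_le
  exact_mod_cast this

theorem p_le_bound : (i.p : ℤ) ≤ i.bound := by
  have := i.two_le
  have := i.three_le
  unfold bound
  nlinarith

theorem N_le_bound : (2 : ℤ) ^ i.n ≤ i.bound := by
  have := i.two_le
  have := i.three_le
  unfold bound
  nlinarith

theorem natCast_mem : (i.p : CycRing i.n) ∈ i.𝔭 := by
  have h : (i.p : CycRing i.n) ∈ Ideal.span {(i.p : CycRing i.n), ofCoeffs i.n i.g} :=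
    Ideal.subset_span (by simp)
  rwa [← i.eq_span] at h

theorem mem_eq_coeffAt {a : ℤ} (h₀ : 0 ≤ a) (h₁ : a < 2 ^ i.n) :
    i.mem a = coeffAt a (ofCoeffs i.n i.g) := by
  lift a to ℕ using h₀
  have h₂ : a < 2 ^ i.n := by exact_mod_cast h₁
  rw [coeffAt_ofCoeffs i.g ⟨a, h₂⟩]
  simp only [mem, inputState, Int.toNat_natCast]
  rw [dif_pos ⟨Int.natCast_nonneg a, h₂⟩]

theorem mem_eq_zero {a : ℤ} (h : a < 0 ∨ 2 ^ i.n ≤ a) : i.mem a = 0 := by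
  have h₀ : ¬ (0 ≤ a ∧ a.toNat < 2 ^ i.n) := by
    rintro ⟨h₁, h₂⟩
    have h₃ : (a.toNat : ℤ) < 2 ^ i.n := by exact_mod_cast h₂
    rw [Int.toNat_of_nonneg h₁] at h₃
    omega
  simp only [mem, inputState]
  rw [dif_neg h₀]

/-- In this range the Euclidean quotient by N is 0 or -1, so 1 + 2 (a / N) is the sign of the
antiperiodic extension. The program can thus read shifted coefficients without branching. -/
theorem mem_mod_mul_eq_coeffAt {a : ℤ} (h₀ : -2 ^ i.n ≤ a) (h₁ : a < 2 ^ i.n) :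
    i.mem (a % 2 ^ i.n) * (1 + 2 * (a / 2 ^ i.n)) = coeffAt a (ofCoeffs i.n i.g) := by
  rcases lt_or_ge a 0 with ha | ha
  · have h₂ := coeffAt_add_period a (ofCoeffs i.n i.g)
    have h₃ : a % 2 ^ i.n = a + 2 ^ i.n := by
      rw [← Int.add_emod_right, Int.emod_eq_of_lt (by linarith) (by linarith)]
    have h₄ : a / 2 ^ i.n = -1 := by
      rw [Int.ediv_eq_iff_of_pos (by linarith [i.two_le])]
      constructor <;> linarith
    rw [h₃, h₄, i.mem_eq_coeffAt (by linarith) (by linarith), h₂]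
    ring
  · rw [Int.emod_eq_of_lt ha h₁, Int.ediv_eq_zero_of_lt ha h₁, i.mem_eq_coeffAt ha h₁]
    ring

theorem bdd_inputState : (inputState (2 ^ i.n) i.p i.g).Bdd i.bound := by
  have h₀ := i.p_le_bound
  have h₁ := i.N_le_bound
  have h₂ := i.two_le
  have h₃ := i.three_le
  refine ⟨fun r => ?_, fun a => ?_⟩
  · simp only [inputState]
    split_ifs
    · push_cast
      rwa [abs_of_nonneg (by linarith)]
    · rwa [abs_of_nonneg (by linarith)]
    · rw [abs_zero]
      linarith
  · simp only [inputState]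
    split_ifs
    · exact (i.abs_lt _).le.trans h₀
    · rw [abs_zero]
      linarith

theorem one_le_size : 1 ≤ i.size := by
  have := Nat.two_pow_pos i.n
  unfold size
  omega

end Inst

/-- From states satisfying `P` the program `c` leads to states satisfying `Q`, and its running time
is at most a constant times the unit `size * bitLen bound ^ 2`. -/
def Fast (P : Inst → State → Prop) (c : Prog) (Q : Inst → State → Prop) : Prop :=
  ∃ k : ℕ, ∀ (i : Inst) (s : State), s.Bdd i.bound → P i s →
    Runs i.bound c (k * (i.size * bitLen i.bound ^ 2)) s (Q i)

theorem Fast.of_wp {P Q : Inst → State → Prop} {c : Prog}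
    (h : ∀ i s, s.Bdd i.bound → P i s → wp i.bound c (Q i) s) : Fast P c Q := by
  obtain ⟨k, hk⟩ := exists_runs_of_wp c
  refine ⟨k, fun i s hb hP => (hk _ s _ hb (h i s hb hP)).mono ?_ fun _ _ h => h⟩
  exact Nat.mul_le_mul_left _ (Nat.le_mul_of_pos_left _ i.one_le_size)

theorem Fast.seq {P Q R : Inst → State → Prop} {c₁ c₂ : Prog} (h₁ : Fast P c₁ Q)
    (h₂ : Fast Q c₂ R) : Fast P (.seq c₁ c₂) R := by
  obtain ⟨k₁, h₁⟩ := h₁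
  obtain ⟨k₂, h₂⟩ := h₂
  refine ⟨k₁ + k₂, fun i s hb hP => ?_⟩
  rw [add_mul]
  exact (h₁ i s hb hP).seq fun s' hb' hQ => h₂ i s' hb' hQ

theorem Fast.ite {P Q : Inst → State → Prop} {e : Expr} {c₁ c₂ : Prog}
    (h₁ : Fast (fun i s => P i s ∧ 0 < e.eval s) c₁ Q)
    (h₂ : Fast (fun i s => P i s ∧ ¬ 0 < e.eval s) c₂ Q) : Fast P (.ite e c₁ c₂) Q := by
  obtain ⟨k, hk⟩ := e.exists_cost_le
  obtain ⟨k₁, h₁⟩ := h₁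
  obtain ⟨k₂, h₂⟩ := h₂
  refine ⟨k + 1 + k₁ + k₂, fun i s hb hP => ?_⟩
  have h₃ := (hk _ s hb).2
  have h₄ : 1 ≤ bitLen i.bound ^ 2 := Nat.one_le_pow _ _ (one_le_bitLen _)
  have h₅ : bitLen i.bound ^ 2 ≤ i.size * bitLen i.bound ^ 2 :=
    Nat.le_mul_of_pos_left _ i.one_le_size
  have h₆ := Nat.mul_le_mul_left k h₅
  have h₇ : (k + 1 + k₁ + k₂) * (i.size * bitLen i.bound ^ 2) =
      k * (i.size * bitLen i.bound ^ 2) + i.size * bitLen i.bound ^ 2 +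
        k₁ * (i.size * bitLen i.bound ^ 2) + k₂ * (i.size * bitLen i.bound ^ 2) := by ring
  by_cases he : 0 < e.eval s
  · obtain ⟨t, s', hx, ht, hb', hQ⟩ := h₁ i s hb ⟨hP, he⟩
    exact ⟨_, s', .ite_true he hx, by omega, hb', hQ⟩
  · obtain ⟨t, s', hx, ht, hb', hQ⟩ := h₂ i s hb ⟨hP, he⟩
    exact ⟨_, s', .ite_false he hx, by omega, hb', hQ⟩

/-- A measure linear in the size suffices, both for loops over the N coordinates and for loops of
O(log p) rounds. -/
theorem Fast.while {P Q : Inst → State → Prop} {e : Expr} {c : Prog}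
    (I : Inst → State → Prop) (μ : Inst → State → ℕ) (l : ℕ) (hPI : ∀ i s, P i s → I i s)
    (hμ : ∀ i s, P i s → μ i s + 1 ≤ l * i.size)
    (hI : ∀ i s, s.Bdd i.bound → I i s → 0 < e.eval s →
      wp i.bound c (fun s' => I i s' ∧ μ i s' < μ i s) s)
    (hIQ : ∀ i s, I i s → ¬ 0 < e.eval s → Q i s) : Fast P (.while e c) Q := by
  obtain ⟨k, hk⟩ := exists_runs_while e c
  refine ⟨l * k, fun i s hb hP => (hk _ (I i) (μ i) (hI i) s hb (hPI i s hP)).mono ?_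
    fun s' _ h => hIQ i s' h.1 h.2⟩
  calc (μ i s + 1) * (k * bitLen i.bound ^ 2) ≤ l * i.size * (k * bitLen i.bound ^ 2) :=
        Nat.mul_le_mul_right _ (hμ i s hP)
    _ = l * k * (i.size * bitLen i.bound ^ 2) := by ring

theorem bitLen_bound_le (i : Inst) : bitLen i.bound ≤ i.size := by
  have h₁ : i.bound.natAbs = 2 ^ i.n * i.p := by
    unfold Inst.bound
    rw [← Int.natAbs_natCast (2 ^ i.n * i.p)]
    push_cast
    rfl
  have h₂ := size_mul_le (2 ^ i.n) i.p
  have h₃ : i.p.size ≤ Nat.log 2 i.p + 1 :=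
    Nat.size_le.mpr (Nat.lt_pow_succ_log_self one_lt_two _)
  have h₄ : (2 ^ i.n).size = i.n + 1 := Nat.size_pow
  have h₅ : i.n < 2 ^ i.n := Nat.lt_two_pow_self
  unfold bitLen Inst.size
  rw [h₁]
  omega

theorem log_le_size (i : Inst) : Nat.log 2 i.p + 3 ≤ i.size := by
  have := Nat.two_pow_pos i.n
  unfold Inst.size
  omega

end IdealSVP

namespace IdealSVP

/-! ### The program -/

@[simp] theorem State.setReg_reg (s : State) (r q : ℕ) (z : ℤ) :
    (s.setReg r z).reg q = if q = r then z else s.reg q := by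
  simp [State.setReg, Function.update_apply]

@[simp] theorem State.setReg_mem (s : State) (r : ℕ) (z : ℤ) : (s.setReg r z).mem = s.mem := rfl

@[simp] theorem State.setMem_reg (s : State) (a z : ℤ) : (s.setMem a z).reg = s.reg := rfl

@[simp] theorem State.setMem_mem (s : State) (a z b : ℤ) :
    (s.setMem a z).mem b = if b = a then z else s.mem b := by
  simp [State.setMem, Function.update_apply]

open IdealSVP.Expr IdealSVP.Prog

/-- Sets register `2` to `d`, and prepares the computation of a square root of `-d`. -/
def initProg : Prog :=
  -- (7 - p mod 8) / 2 is 2 for residue 3 and 1 for residue 5.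
  .seq (assign 2 (div (sub (const 7) (mod (reg 1) (const 8))) (const 2)))
  (.seq (assign 3 (sub (add (div (reg 1) (const 4)) (reg 2)) (const 1)))
  (.seq (assign 4 (sub (const 6) (mul (const 4) (reg 2))))
  (assign 5 (const 1))))

/-- Multiplies register `5` by register `4` to the power register `3`, modulo `p`. -/
def powProg : Prog :=
  .while (reg 3)
    -- The factor 1 + (e mod 2)(base - 1) is the base or 1 according to the last bit of the exponent
    -- e.
    (.seq (assign 5 (mod (mul (reg 5) (add (const 1) (mul (mod (reg 3) (const 2))
      (sub (reg 4) (const 1))))) (reg 1)))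
    (.seq (assign 4 (mod (mul (reg 4) (reg 4)) (reg 1)))
    (assign 3 (div (reg 3) (const 2)))))

/-- The first multiple of `p` of the form `x² + d y²`. -/
def firstProg : Prog :=
  .seq (assign 6 (const 1))
  (assign 7 (div (add (mul (reg 5) (reg 5)) (reg 2)) (reg 1)))

/-- The expression for the residue of least absolute value. -/
def centredModExpr (e m : Expr) : Expr :=
  sub (mod (add e (div m (const 2))) m) (div m (const 2))

/-- Fermat descent. -/
def descentProg : Prog :=
  .while (sub (reg 7) (const 1))
    (.seq (assign 8 (centredModExpr (reg 5) (reg 7)))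
    (.seq (assign 9 (centredModExpr (reg 6) (reg 7)))
    (.seq (assign 10 (div (add (mul (reg 5) (reg 8)) (mul (mul (reg 2) (reg 6)) (reg 9))) (reg 7)))
    (.seq (assign 6 (div (sub (mul (reg 5) (reg 9)) (mul (reg 6) (reg 8))) (reg 7)))
    (.seq (assign 5 (reg 10))
    (assign 7 (div (add (mul (reg 8) (reg 8)) (mul (reg 2) (mul (reg 9) (reg 9))))
      (reg 7))))))))

/-- Prepares the sign test. -/
def setupProg : Prog :=
  .seq (assign 11 (div (reg 0) (mul (const 2) (reg 2))))
  (.seq (assign 13 (const 0))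
  (assign 12 (reg 0)))

/-- The expression for the antiperiodic extension of the input vector. -/
def extExpr (e : Expr) : Expr :=
  mul (load (mod e (reg 0))) (add (const 1) (mul (const 2) (div e (reg 0))))

/-- The sign test: register `13` is zero in the end if and only if `p` divides `(x - y s) g`. -/
def testProg : Prog :=
  .while (reg 12)
    (.seq (assign 12 (sub (reg 12) (const 1)))
    (assign 13 (add (reg 13) (mod
      (sub (mul (reg 5) (load (reg 12)))
        (mul (reg 6) (add (extExpr (sub (reg 12) (reg 11)))
          (mul (sub (reg 2) (const 1))
            (extExpr (sub (reg 12) (mul (const 3) (reg 11))))))))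
      (reg 1)))))

/-- Adjusts the sign. -/
def signProg : Prog :=
  .seq (.ite (reg 13) (assign 6 (sub (const 0) (reg 6))) .skip)
  (assign 12 (reg 0))

/-- Clears the memory. -/
def clearProg : Prog :=
  .while (reg 12)
    (.seq (assign 12 (sub (reg 12) (const 1)))
    (store (reg 12) (const 0)))

/-- Writes the coefficients of `x + y s`. -/
def writeProg : Prog :=
  .seq (store (const 0) (reg 5))
  -- For d = 1 this writes 0 into a cell beyond the output.
  (.seq (store (mul (const 3) (reg 11)) (mul (sub (reg 2) (const 1)) (reg 6)))
  (store (reg 11) (reg 6)))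

/-- Writes `(p, 0)`. -/
def inertProg : Prog :=
  .seq (store (const 0) (reg 1)) (store (const 1) (const 0))

/-- Finds a shortest vector. -/
def svpProg : Prog :=
  .seq initProg
  -- As N ≥ 2, 2d > N occurs only for N = 2 and d = 2, the inert case.
  (.ite (sub (mul (const 2) (reg 2)) (reg 0)) inertProg
  (.seq powProg (.seq firstProg (.seq descentProg (.seq setupProg (.seq testProg
    (.seq signProg (.seq clearProg writeProg))))))))

/-! ### Its correctness and its running time -/

/-- The registers that hold `N`, `p`, `d`. -/
def Frame (i : Inst) (s : State) : Prop :=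
  s.reg 0 = 2 ^ i.n ∧ s.reg 1 = i.p ∧ s.reg 2 = i.d

def AfterInit (i : Inst) (s : State) : Prop :=
  Frame i s ∧ s.mem = i.mem ∧ s.reg 3 = (i.p / 4 + (i.d - 1).toNat : ℕ) ∧
    s.reg 4 = 6 - 4 * i.d ∧ s.reg 5 = 1

theorem fast_initProg :
    Fast (fun i s => s = inputState (2 ^ i.n) i.p i.g) initProg AfterInit := by
  refine Fast.of_wp ?_
  rintro i _ - rfl
  have h₀ := i.p_le_bound
  have h₁ := i.three_le
  have hd : (7 - (i.p : ℤ) % 8) / 2 = i.d := by have := i.d_cases; omega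
  simp [wp, initProg, Expr.eval, AfterInit, Frame, inputState, hd]
  have hd := i.d_cases
  refine ⟨?_, ?_, ?_, ?_, by simp [Inst.mem, inputState], ?_⟩
  · rw [abs_le]; omega
  · rw [abs_le]; omega
  · rw [abs_le]; omega
  · omega
  · omega

def PowInv (i : Inst) (s : State) : Prop :=
  Frame i s ∧ s.mem = i.mem ∧ 0 ≤ s.reg 3 ∧ 0 ≤ s.reg 5 ∧ s.reg 5 < i.p ∧
    (s.reg 5 : ZMod i.p) * (s.reg 4 : ZMod i.p) ^ (s.reg 3).toNat =
      ((6 - 4 * i.d : ℤ) : ZMod i.p) ^ (i.p / 4 + (i.d - 1).toNat)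

def AfterPow (i : Inst) (s : State) : Prop :=
  Frame i s ∧ s.mem = i.mem ∧ 0 ≤ s.reg 5 ∧ s.reg 5 < i.p ∧ (i.p : ℤ) ∣ s.reg 5 ^ 2 + i.d

theorem fast_powProg : Fast AfterInit powProg AfterPow := by
  -- The measure is the bit length of the exponent, lowered by each halving.
  refine Fast.while PowInv (fun _ s => (s.reg 3).toNat.size) 1 ?_ ?_ ?_ ?_
  · rintro i s ⟨hF, hm, h3, h4, h5⟩
    have := i.three_le
    exact ⟨hF, hm, by omega, by omega, by omega, by
      rw [h3, h4, h5, Int.toNat_natCast]; simp⟩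
  · rintro i s ⟨hF, hm, h3, h4, h5⟩
    rw [h3, Int.toNat_natCast]
    have h₁ : (i.p / 4 + (i.d - 1).toNat).size ≤ Nat.log 2 i.p + 1 := by
      refine Nat.size_le.mpr (lt_of_le_of_lt ?_ (Nat.lt_pow_succ_log_self one_lt_two i.p))
      have := i.d_cases
      omega
    have := log_le_size i
    omega
  · rintro i s hb ⟨⟨hN, hp, hd⟩, hm, h3, h5, h5p, hpow⟩ he
    have hp0 : (0 : ℤ) < i.p := by have := i.three_le; omega
    have hb₀ := i.p_le_bound
    have hmod : ∀ z : ℤ, |z % i.p| ≤ i.bound := fun z => by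
      rw [abs_of_nonneg (Int.emod_nonneg _ hp0.ne')]
      exact (Int.emod_lt_of_pos _ hp0).le.trans hb₀
    have h3b := hb.1 3
    simp only [Expr.eval] at he
    rw [abs_of_pos he] at h3b
    simp [wp, Expr.eval, PowInv, Frame, hN, hp, hd, hm, hmod]
    refine ⟨?_, ⟨?_, Int.emod_nonneg _ hp0.ne', Int.emod_lt_of_pos _ hp0, ?_⟩, ?_⟩
    · rw [abs_of_nonneg (by omega)]; omega
    · omega
    · have hR : (6 - 4 * (i.d : ZMod i.p)) ^ (i.p / 4 + (i.d.toNat - 1)) =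
          ((6 - 4 * i.d : ℤ) : ZMod i.p) ^ (i.p / 4 + (i.d - 1).toNat) := by simp
      rw [hR, ← hpow]
      obtain ⟨e, he'⟩ := Int.eq_ofNat_of_zero_le h3
      rw [he']
      have h₁ : ((e : ℤ) / 2).toNat = e / 2 := by omega
      rw [h₁, Int.toNat_natCast]
      rcases Nat.even_or_odd' e with ⟨c, rfl | rfl⟩
      · have h₂ : (2 * c / 2) = c := by omega
        rw [h₂, pow_mul]
        simp [sq]
      · have h₂ : ((2 * c + 1) / 2) = c := by omega
        have h₃ : (((2 * c + 1 : ℕ) : ℤ) % 2) = 1 := by omega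
        rw [h₂, h₃, pow_succ, pow_mul]
        simp
        ring
    · have h₁ : (s.reg 3 / 2).toNat = (s.reg 3).toNat / 2 := by omega
      rw [h₁]
      have h₂ : 0 < (s.reg 3).toNat.size := Nat.size_pos.mpr (by omega)
      obtain ⟨c, hc⟩ : ∃ c, (s.reg 3).toNat.size = c + 1 := ⟨_, (Nat.sub_add_cancel h₂).symm⟩
      have h₃ := Nat.lt_size_self (s.reg 3).toNat
      rw [hc, pow_succ] at h₃
      rw [hc, Nat.lt_succ_iff, Nat.size_le]
      omega
  · rintro i s ⟨hF, hm, h3, h5, h5p, hpow⟩ he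
    simp only [Expr.eval] at he
    have : s.reg 3 = 0 := by omega
    rw [this] at hpow
    exact ⟨hF, hm, h5, h5p, i.compatible.dvd_sq_add (by simpa using hpow)⟩

def DescentInv (i : Inst) (s : State) : Prop :=
  Frame i s ∧ s.mem = i.mem ∧ s.reg 5 ^ 2 + i.d * s.reg 6 ^ 2 = s.reg 7 * i.p ∧
    0 < s.reg 7 ∧ s.reg 7 < i.p

theorem fast_firstProg : Fast AfterPow firstProg DescentInv := by
  refine Fast.of_wp ?_
  rintro i s hb ⟨⟨hN, hp, hd⟩, hm, h5, h5p, hdvd⟩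
  have hd' := i.d_cases
  have hd₁ : 1 ≤ i.d ∧ i.d ≤ 2 := by omega
  have hp3 := i.three_le
  have hb₀ := i.p_le_bound
  obtain ⟨m, hm'⟩ := hdvd
  have hq : (s.reg 5 * s.reg 5 + i.d) / i.p = m := by
    rw [← sq, hm', Int.mul_ediv_cancel_left _ (by omega)]
  have hm0 : 0 < m := by
    have : 0 < (i.p : ℤ) * m := by rw [← hm']; nlinarith
    exact pos_of_mul_pos_right this (by omega)
  have hmp : m < i.p := by nlinarith
  simp [wp, firstProg, Expr.eval, DescentInv, Frame, hN, hp, hd, hm, hq, hm0, hmp]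
  refine ⟨by omega, by rw [abs_of_pos hm0]; omega, by rw [hm', mul_comm]⟩

def AfterDescent (i : Inst) (s : State) : Prop :=
  Frame i s ∧ s.mem = i.mem ∧ s.reg 5 ^ 2 + i.d * s.reg 6 ^ 2 = i.p

theorem abs_le_of_sq_add {x y d m p : ℤ} (hd : 1 ≤ d) (hm : m ≤ p) (hp : 0 ≤ p)
    (h : x ^ 2 + d * y ^ 2 = m * p) : |x| ≤ p ∧ |y| ≤ p := by
  constructor <;> refine abs_le_of_sq_le_sq ?_ hp
  · nlinarith [mul_nonneg (by omega : 0 ≤ d) (sq_nonneg y)]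
  · nlinarith [sq_nonneg x, mul_nonneg (by omega : 0 ≤ d - 1) (sq_nonneg y)]

theorem fast_descentProg : Fast DescentInv descentProg AfterDescent := by
  -- A factor 3/4 need not lower log₂ m, but (3/4)³ = 27/64 < 1/2, so log₂ (m³) drops by at least 1
  -- in each round.
  refine Fast.while DescentInv (fun _ s => Nat.log 2 ((s.reg 7).toNat ^ 3)) 3
    (fun _ _ h => h) ?_ ?_ ?_
  · rintro i s ⟨hF, hm, h, h7, h7p⟩
    have h₁ := log_le_size i
    have h₂ : Nat.log 2 ((s.reg 7).toNat ^ 3) < 3 * (Nat.log 2 i.p + 1) := by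
      refine Nat.log_lt_of_lt_pow (pow_ne_zero 3 (by omega)) ?_
      rw [mul_comm, pow_mul]
      refine Nat.pow_lt_pow_left (lt_trans ?_ (Nat.lt_pow_succ_log_self one_lt_two i.p)) (by omega)
      omega
    omega
  · rintro i s hb ⟨⟨hN, hp, hd⟩, hm, h, h7, h7p⟩ he
    simp only [Expr.eval] at he
    have hd' : 1 ≤ i.d ∧ i.d ≤ 2 := by have := i.d_cases; omega
    have hp3 := i.three_le
    have hb₀ := i.p_le_bound
    have ec : ∀ x m : ℤ, (x + m / 2) % m - m / 2 = centredMod x m := fun _ _ => rfl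
    have hr := two_mul_abs_centredMod_le (s.reg 5) h7
    have ht := two_mul_abs_centredMod_le (s.reg 6) h7
    obtain ⟨h₁, h₂, h₃⟩ := descent_step (Nat.prime_iff_prime_int.mp i.compatible.1) hd'.1 hd'.2 h
      (by omega) h7p (dvd_sub_centredMod _ _) (dvd_sub_centredMod _ _) hr ht
    simp [wp, Expr.eval, centredModExpr, DescentInv, Frame, hN, hp, hd, hm, ec]
    simp only [← sq]
    generalize centredMod (s.reg 5) (s.reg 7) = r at *
    generalize centredMod (s.reg 6) (s.reg 7) = t at *
    generalize (s.reg 5 * r + i.d * s.reg 6 * t) / s.reg 7 = X at *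
    generalize (s.reg 5 * t - s.reg 6 * r) / s.reg 7 = Y at *
    generalize (r ^ 2 + i.d * t ^ 2) / s.reg 7 = m' at *
    obtain ⟨hX, hY⟩ := abs_le_of_sq_add hd'.1 (by omega) (by omega) h₁
    refine ⟨by omega, by omega, by omega, by omega, by omega, by rw [abs_of_pos h₂]; omega,
      ⟨h₁, h₂, by omega⟩, ?_⟩
    lift m' to ℕ using h₂.le
    obtain ⟨m, hm7⟩ := Int.eq_ofNat_of_zero_le h7.le
    rw [hm7] at h₃ ⊢
    simp only [Int.toNat_natCast]
    have h₄ : 4 * m' ≤ 3 * m := by omega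
    have h₅ : m' ^ 3 * 2 ≤ m ^ 3 := by
      have := Nat.pow_le_pow_left h₄ 3
      rw [mul_pow, mul_pow] at this
      omega
    have h₆ : m' ≠ 0 := by omega
    rw [← Nat.succ_le_iff, Nat.succ_eq_add_one, ← Nat.log_mul_base one_lt_two (by positivity)]
    exact Nat.log_mono_right h₅
  · rintro i s ⟨hF, hm, h, h7, h7p⟩ he
    simp only [Expr.eval] at he
    have : s.reg 7 = 1 := by omega
    exact ⟨hF, hm, by rw [h, this, one_mul]⟩

end IdealSVP

/-! ### Sign test and output of the generator -/

namespace IdealSVP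

/-- The representation `p = x² + d y²`. -/
def Inst.Done (i : Inst) (x y : ℤ) : Prop :=
  x ^ 2 + i.d * y ^ 2 = i.p

/-- The exponent `K`. -/
def Inst.step (i : Inst) : ℤ := 2 ^ i.n / (2 * i.d)

/-- The split case: `(N, p mod 8) ≠ (2, 3)`. -/
def Inst.Split (i : Inst) : Prop := 2 * i.d ≤ 2 ^ i.n

theorem Inst.Split.exists_isStep {i : Inst} (h : i.Split) :
    ∃ K : ℕ, i.step = K ∧ IsStep i.n K i.d := by
  obtain ⟨l, hl⟩ : ∃ l, i.n = l + 1 := ⟨i.n - 1, by have := i.one_le; omega⟩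
  unfold Inst.Split at h
  rw [hl, pow_succ'] at h
  rcases i.d_cases with ⟨-, hd⟩ | ⟨-, hd⟩
  · obtain ⟨m, rfl⟩ : ∃ m, l = m + 1 := by
      refine ⟨l - 1, ?_⟩
      rcases l with _ | l
      · rw [hd] at h; norm_num at h
      · omega
    refine ⟨2 ^ m, ?_, .inr ⟨hd, by rw [hl]; ring⟩⟩
    rw [Inst.step, hl, hd]
    push_cast
    rw [show (2 : ℤ) ^ (m + 1 + 1) = 2 ^ m * (2 * 2) by ring]
    exact Int.mul_ediv_cancel _ (by norm_num)
  · refine ⟨2 ^ l, ?_, .inl ⟨hd, by rw [hl]; ring⟩⟩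
    rw [Inst.step, hl, hd]
    push_cast
    rw [show (2 : ℤ) ^ (l + 1) = 2 ^ l * (2 * 1) by ring]
    exact Int.mul_ediv_cancel _ (by norm_num)

theorem Inst.Split.step_pos {i : Inst} (h : i.Split) : 0 < i.step ∧ i.step < 2 ^ i.n ∧
    (i.d = 1 ∧ 2 * i.step = 2 ^ i.n ∨ i.d = 2 ∧ 4 * i.step = 2 ^ i.n) := by
  obtain ⟨K, hK, hs⟩ := h.exists_isStep
  have h₂ := i.two_le
  rw [hK]
  have h₃ : i.d = 1 ∧ 2 * (K : ℤ) = 2 ^ i.n ∨ i.d = 2 ∧ 4 * (K : ℤ) = 2 ^ i.n := by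
    rcases hs with ⟨hd, h⟩ | ⟨hd, h⟩
    · exact .inl ⟨hd, by exact_mod_cast h⟩
    · exact .inr ⟨hd, by exact_mod_cast h⟩
  refine ⟨?_, ?_, h₃⟩ <;> rcases h₃ with h | h <;> omega

/-- The `j`-th coefficient of `(x - y s) g`. -/
noncomputable def Inst.testCoeff (i : Inst) (x y j : ℤ) : ℤ :=
  x * coeffAt j (ofCoeffs i.n i.g) - y * (coeffAt (j - i.step) (ofCoeffs i.n i.g) +
    (i.d - 1) * coeffAt (j - 3 * i.step) (ofCoeffs i.n i.g))

theorem Inst.testCoeff_eq {i : Inst} {K : ℕ} (h : i.step = K) (x y j : ℤ) :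
    i.testCoeff x y j = coeffAt j (gen i.n K i.d x (-y) * ofCoeffs i.n i.g) := by
  rw [coeffAt_gen_mul, Inst.testCoeff, h]
  ring

def SetupState (i : Inst) (s : State) : Prop :=
  Frame i s ∧ s.mem = i.mem ∧ i.Done (s.reg 5) (s.reg 6) ∧ s.reg 11 = i.step

def AfterSetup (i : Inst) (s : State) : Prop :=
  i.Split ∧ SetupState i s ∧ s.reg 12 = 2 ^ i.n ∧ s.reg 13 = 0

/-- Register 13 sums residues in [0, p): it vanishes exactly when all of them do, and it stays below
N p, which is the reason for the factor 2^n in `Inst.bound`. -/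
def TestInv (i : Inst) (s : State) : Prop :=
  i.Split ∧ SetupState i s ∧ 0 ≤ s.reg 12 ∧ s.reg 12 ≤ 2 ^ i.n ∧ 0 ≤ s.reg 13 ∧
    s.reg 13 ≤ (2 ^ i.n - s.reg 12) * i.p ∧
    (s.reg 13 = 0 ↔ ∀ j, s.reg 12 ≤ j → j < 2 ^ i.n →
      (i.p : ℤ) ∣ i.testCoeff (s.reg 5) (s.reg 6) j)

def AfterTest (i : Inst) (s : State) : Prop :=
  i.Split ∧ SetupState i s ∧ 0 ≤ s.reg 13 ∧
    (s.reg 13 = 0 ↔ ∀ j, 0 ≤ j → j < 2 ^ i.n →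
      (i.p : ℤ) ∣ i.testCoeff (s.reg 5) (s.reg 6) j)

theorem fast_setupProg :
    Fast (fun i s => i.Split ∧ AfterDescent i s) setupProg AfterSetup := by
  refine Fast.of_wp ?_
  rintro i s hb ⟨hsplit, ⟨hN, hp, hd⟩, hm, h⟩
  have h₁ := hsplit.step_pos
  have h₂ := i.N_le_bound
  have h₃ := i.two_le
  have hstep : 2 ^ i.n / (2 * i.d) = i.step := rfl
  simp [wp, setupProg, Expr.eval, AfterSetup, SetupState, Inst.Done, Frame, hN, hp, hd, hm, hstep,
    h, hsplit]
  refine ⟨?_, ?_, ?_⟩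
  · rw [abs_of_pos h₁.1]; omega
  · omega
  · exact h₂

theorem fast_testProg : Fast AfterSetup testProg AfterTest := by
  refine Fast.while TestInv (fun _ s => (s.reg 12).toNat) 1 ?_ ?_ ?_ ?_
  · rintro i s ⟨hsplit, hs, h12, h13⟩
    have := i.two_le
    refine ⟨hsplit, hs, by omega, by omega, by omega, by rw [h12, h13]; simp, ?_⟩
    rw [h12, h13]
    exact ⟨fun _ j h₁ h₂ => absurd h₁ (by omega), fun _ => rfl⟩
  · rintro i s ⟨hsplit, hs, h12, h13⟩
    have h : (s.reg 12).toNat = 2 ^ i.n := by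
      rw [h12]; exact_mod_cast Int.toNat_natCast (2 ^ i.n)
    rw [h]
    unfold Inst.size
    omega
  · rintro i s hb ⟨hsplit, ⟨⟨hN, hp, hd⟩, hm, hdone, h11⟩, h12, h12N, h13, h13b, hiff⟩ he
    simp only [Expr.eval] at he
    have hp3 := i.three_le
    have hb12 := hb.1 12
    rw [abs_of_pos he] at hb12
    obtain ⟨hst₀, hst₁, hst⟩ := hsplit.step_pos
    set j := s.reg 12 - 1 with hj
    have e₁ : i.mem j = coeffAt j (ofCoeffs i.n i.g) := i.mem_eq_coeffAt (by omega) (by omega)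
    have e₂ := i.mem_mod_mul_eq_coeffAt (a := j - i.step) (by omega) (by omega)
    have e₃ : (i.d - 1) * (i.mem ((j - 3 * i.step) % 2 ^ i.n) *
        (1 + 2 * ((j - 3 * i.step) / 2 ^ i.n))) =
        (i.d - 1) * coeffAt (j - 3 * i.step) (ofCoeffs i.n i.g) := by
      -- For d = 1 the index may fall below -N, but the factor d - 1 = 0 removes the term.
      rcases hst with ⟨h, -⟩ | ⟨-, h⟩
      · rw [h]; ring
      · rw [i.mem_mod_mul_eq_coeffAt (by omega) (by omega)]
    have hT₀ := Int.emod_nonneg (i.testCoeff (s.reg 5) (s.reg 6) j) (by omega : (i.p : ℤ) ≠ 0)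
    have hT₁ := Int.emod_lt_of_pos (i.testCoeff (s.reg 5) (s.reg 6) j) (by omega : (0 : ℤ) < i.p)
    have hT : i.testCoeff (s.reg 5) (s.reg 6) j % i.p = 0 ↔
        (i.p : ℤ) ∣ i.testCoeff (s.reg 5) (s.reg 6) j := Int.dvd_iff_emod_eq_zero.symm
    have hTdef : s.reg 5 * coeffAt j (ofCoeffs i.n i.g) - s.reg 6 *
        (coeffAt (j - i.step) (ofCoeffs i.n i.g) +
          (i.d - 1) * coeffAt (j - 3 * i.step) (ofCoeffs i.n i.g)) =
        i.testCoeff (s.reg 5) (s.reg 6) j := rfl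
    simp [wp, extExpr, Expr.eval, TestInv, SetupState, Inst.Done, Frame, hN, hp, hd, hm, h11,
      ← hj, e₁, e₂, e₃, hTdef, hsplit]
    generalize i.testCoeff (s.reg 5) (s.reg 6) j % i.p = T at *
    have hle : s.reg 13 + T ≤ (2 ^ i.n - j) * i.p := by
      rw [hj]
      linarith
    have hle' : s.reg 13 + T ≤ i.bound := hle.trans (by
      unfold Inst.bound
      exact mul_le_mul_of_nonneg_right (by omega) (by omega))
    refine ⟨?_, ?_, ⟨hdone, ?_, ?_, ?_, hle, ?_⟩, ?_⟩
    · rw [abs_le]; omega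
    · rw [abs_le]; omega
    · omega
    · omega
    · omega
    · have h₁ : s.reg 13 + T = 0 ↔ s.reg 13 = 0 ∧ T = 0 := by omega
      rw [h₁, hiff, hT]
      constructor
      · rintro ⟨h₂, h₃⟩ l hl₀ hl₁
        rcases eq_or_lt_of_le hl₀ with rfl | hl
        · exact h₃
        · exact h₂ l (by omega) hl₁
      · intro h₂
        exact ⟨fun l hl₀ hl₁ => h₂ l (by omega) hl₁, h₂ j le_rfl (by omega)⟩
    · omega
  · rintro i s ⟨hsplit, hs, h12, h12N, h13, h13b, hiff⟩ he
    simp only [Expr.eval] at he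
    have h0 : s.reg 12 = 0 := by omega
    rw [h0] at hiff
    exact ⟨hsplit, hs, h13, hiff⟩

/-- The quantifier over K merely converts the integer `i.step` into a natural exponent. -/
def SignState (i : Inst) (s : State) : Prop :=
  i.Split ∧ s.reg 2 = i.d ∧ s.reg 11 = i.step ∧ i.Done (s.reg 5) (s.reg 6) ∧
    ∀ K : ℕ, i.step = K → gen i.n K i.d (s.reg 5) (s.reg 6) ∈ i.𝔭

def AfterSign (i : Inst) (s : State) : Prop :=
  SignState i s ∧ s.mem = i.mem ∧ s.reg 12 = 2 ^ i.n

theorem fast_signProg : Fast AfterTest signProg AfterSign := by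
  refine Fast.of_wp ?_
  rintro i s hb ⟨hsplit, ⟨⟨hN, hp, hd⟩, hm, hdone, h11⟩, h13, hiff⟩
  have h₂ := i.N_le_bound
  have hb6 := hb.1 6
  obtain ⟨K, hK, hstep⟩ := hsplit.exists_isStep
  have hmem : s.reg 13 = 0 ↔ gen i.n K i.d (s.reg 5) (s.reg 6) ∈ i.𝔭 := by
    rw [hiff, i.compatible.gen_mem_iff i.one_le hstep hdone i.isPrime i.eq_span, natCast_dvd_iff]
    constructor
    · intro h l hl
      rw [← Inst.testCoeff_eq hK]
      exact h l (by omega) (by exact_mod_cast hl)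
    · intro h l hl₀ hl₁
      lift l to ℕ using hl₀
      rw [Inst.testCoeff_eq hK]
      exact h l (by exact_mod_cast hl₁)
  have hor := hstep.gen_mem_or hdone i.isPrime i.natCast_mem
  have huniq : ∀ L : ℕ, i.step = L → L = K := fun L hL => by rw [hK] at hL; exact_mod_cast hL.symm
  simp [wp, signProg, Expr.eval, AfterSign, SignState, Inst.Done, hN, hd, hm, h11, hsplit, h₂,
    hb6]
  constructor
  · intro hpos
    refine ⟨hdone, fun L hL => ?_⟩
    rw [huniq L hL]
    exact hor.resolve_left fun h => by have := hmem.mpr h; omega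
  · intro hle
    refine ⟨hdone, fun L hL => ?_⟩
    rw [huniq L hL]
    exact hmem.mp (by omega)

def AfterClear (i : Inst) (s : State) : Prop :=
  SignState i s ∧ ∀ a, s.mem a = 0

theorem fast_clearProg : Fast AfterSign clearProg AfterClear := by
  refine Fast.while (fun i s => SignState i s ∧ 0 ≤ s.reg 12 ∧
      ∀ a, a < 0 ∨ s.reg 12 ≤ a → s.mem a = 0) (fun _ s => (s.reg 12).toNat) 1 ?_ ?_ ?_ ?_
  · rintro i s ⟨hs, hm, h12⟩
    have := i.two_le
    refine ⟨hs, by omega, fun a ha => ?_⟩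
    rw [hm]
    exact i.mem_eq_zero (by rwa [h12] at ha)
  · rintro i s ⟨hs, hm, h12⟩
    have h : (s.reg 12).toNat = 2 ^ i.n := by
      rw [h12]; exact_mod_cast Int.toNat_natCast (2 ^ i.n)
    rw [h]
    unfold Inst.size
    omega
  · rintro i s hb ⟨hs, h12, hz⟩ he
    simp only [Expr.eval] at he
    have hb12 := hb.1 12
    rw [abs_of_pos he] at hb12
    have hs' := hs
    unfold SignState at hs'
    simp [wp, Expr.eval, SignState]
    refine ⟨by rw [abs_le]; omega, by omega, ⟨hs', by omega, fun a ha => ?_⟩, by omega⟩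
    intro hne
    exact hz a (by omega)
  · rintro i s ⟨hs, h12, hz⟩ he
    simp only [Expr.eval] at he
    exact ⟨hs, fun a => hz a (by omega)⟩

/-- The memory holds a shortest vector. -/
def Solved (i : Inst) (s : State) : Prop :=
  IsShortestVector (idealLattice i.𝔭) (toEuclidean (outputVec (2 ^ i.n) s))

theorem fast_writeProg : Fast AfterClear writeProg Solved := by
  refine Fast.of_wp ?_
  rintro i s hb ⟨⟨hsplit, hd, h11, hdone, hmem⟩, hz⟩
  obtain ⟨K, hK, hstep⟩ := hsplit.exists_isStep
  have hst := hsplit.step_pos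
  have hb5 := hb.1 5
  have hb6 := hb.1 6
  simp [wp, writeProg, Expr.eval, hd, h11, hb5, hb6]
  constructor
  · rcases hst.2.2 with ⟨h, -⟩ | ⟨h, -⟩ <;> rw [h]
    · simpa using hb.nonneg
    · simpa using hb6
  · have hgen := hstep.ofCoeffs_eq_gen (a := s.reg 5) (b := s.reg 6)
      (v := fun j => if j = i.step then s.reg 6 else if j = 3 * i.step then (i.d - 1) * s.reg 6
        else if j = 0 then s.reg 5 else 0)
      (by rw [if_neg (by omega), if_neg (by omega), if_pos rfl])
      (by rw [if_pos hK.symm])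
      (by rw [if_neg (by omega), if_pos (by rw [hK])])
      (fun j h₀ h₁ h₂ => by rw [if_neg (by omega), if_neg (by omega),
        if_neg (by omega)])
    have := i.compatible.isShortestVector_gen i.one_le hstep hdone i.isPrime (hmem K hK)
    rw [← hgen, coeffEmbedding_ofCoeffs] at this
    unfold Solved outputVec
    convert this using 3
    simp [hz]

theorem fast_inertProg :
    Fast (fun i s => (i.n = 1 ∧ i.p % 8 = 3) ∧ Frame i s) inertProg Solved := by
  refine Fast.of_wp ?_
  rintro i s hb ⟨⟨hn, h8⟩, hN, hp, hd⟩
  have h₀ := i.p_le_bound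
  have h₁ := hb.nonneg
  simp [wp, inertProg, Expr.eval, hp, h₀, h₁]
  obtain ⟨n, p, d, 𝔭, g, one_le, compatible, isPrime, abs_lt, eq_span⟩ := i
  simp only at hn h8
  subst hn
  have hmem := (Inst.mk 1 p d 𝔭 g one_le compatible isPrime abs_lt eq_span).natCast_mem
  have h := isShortestVector_of_inert compatible.1 h8 isPrime hmem
  have hv : (p : CycRing 1) = ofCoeffs 1 ![(p : ℤ), 0] := by
    rw [ofCoeffs_eq_sum]
    change _ = ∑ i : Fin 2, _
    simp [Fin.sum_univ_two]
  rw [hv, coeffEmbedding_ofCoeffs] at h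
  have hout : outputVec (2 ^ 1) ((s.setMem 0 p).setMem 1 0) = ![(p : ℤ), 0] := by
    ext l
    change Fin 2 at l
    fin_cases l <;> simp [outputVec]
  rw [← hout] at h
  exact h

/-- Facts about the instance alone, such as `Inst.Split`, are carried through a program unchanged.
-/
theorem Fast.const {P Q : Inst → State → Prop} {c : Prog} (h : Fast P c Q) (R : Inst → Prop) :
    Fast (fun i s => R i ∧ P i s) c (fun i s => R i ∧ Q i s) := by
  obtain ⟨k, hk⟩ := h
  exact ⟨k, fun i s hb hP => (hk i s hb hP.2).mono le_rfl fun _ _ hQ => ⟨hP.1, hQ⟩⟩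

theorem Fast.weaken {P P' Q : Inst → State → Prop} {c : Prog} (h : Fast P c Q)
    (hP : ∀ i s, P' i s → P i s) : Fast P' c Q := by
  obtain ⟨k, hk⟩ := h
  exact ⟨k, fun i s hb hP' => hk i s hb (hP i s hP')⟩

theorem fast_svpProg :
    Fast (fun i s => s = inputState (2 ^ i.n) i.p i.g) svpProg Solved := by
  refine fast_initProg.seq (Fast.ite (fast_inertProg.weaken ?_) (Fast.weaken
    ((fast_powProg.const Inst.Split).seq ((fast_firstProg.const _).seq
      ((fast_descentProg.const _).seq (fast_setupProg.seq (fast_testProg.seq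
        (fast_signProg.seq (fast_clearProg.seq fast_writeProg))))))) ?_))
  · rintro i s ⟨⟨⟨hN, hp, hd⟩, -⟩, he⟩
    simp only [Expr.eval, hN, hd] at he
    have h₂ := i.two_le
    refine ⟨?_, hN, hp, hd⟩
    have hd' := i.d_cases
    have h₃ : (2 : ℤ) ^ i.n < 2 ^ 2 := by omega
    have h₄ := (pow_lt_pow_iff_right₀ (by norm_num : (1 : ℤ) < 2)).mp h₃
    have := i.one_le
    omega
  · rintro i s ⟨h, he⟩
    have ⟨⟨hN, hp, hd⟩, _⟩ := h
    simp only [Expr.eval, hN, hd] at he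
    exact ⟨by unfold Inst.Split; omega, h⟩

/-! ### The two statements: running time and length √p -/

theorem exists_compatible {p : ℕ} (hp : p.Prime)
    (h : (p : ℤ) ≡ 3 [ZMOD 8] ∨ (p : ℤ) ≡ -3 [ZMOD 8]) : ∃ d, Compatible p d := by
  rcases h with h | h
  · exact ⟨2, hp, .inl ⟨by unfold Int.ModEq at h; omega, rfl⟩⟩
  · exact ⟨1, hp, .inr ⟨by unfold Int.ModEq at h; omega, rfl⟩⟩

/-- The degree three polynomial that bounds the running time, up to a constant. -/
noncomputable def timeBound (k : ℕ) : MvPolynomial (Fin 2) ℕ :=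
  MvPolynomial.C k * (MvPolynomial.X 0 + MvPolynomial.X 1 + 3) ^ 3

theorem exists_program :
    ∃ (c : Prog) (B : MvPolynomial (Fin 2) ℕ),
      ∀ (n p : ℕ) (𝔭 : Ideal (CycRing n)) (g : Fin (2 ^ n) → ℤ),
        1 ≤ n → p.Prime → ((p : ℤ) ≡ 3 [ZMOD 8] ∨ (p : ℤ) ≡ -3 [ZMOD 8]) →
        𝔭.IsPrime → (∀ i, |g i| < (p : ℤ)) →
        𝔭 = Ideal.span {(p : CycRing n), ofCoeffs n g} →
        ∃ (t : ℕ) (s : State), Exec c (inputState (2 ^ n) p g) t s ∧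
          t ≤ MvPolynomial.eval ![2 ^ n, Nat.log 2 p] B ∧
          IsShortestVector (idealLattice 𝔭) (toEuclidean (outputVec (2 ^ n) s)) := by
  obtain ⟨k, hk⟩ := fast_svpProg
  refine ⟨svpProg, timeBound k, fun n p 𝔭 g hn hp hmod h𝔭 hg hspan => ?_⟩
  obtain ⟨d, hd⟩ := exists_compatible hp hmod
  let i : Inst := ⟨n, p, d, 𝔭, g, hn, hd, h𝔭, hg, hspan⟩
  obtain ⟨t, s, hx, ht, -, hs⟩ := hk i _ i.bdd_inputState rfl
  refine ⟨t, s, hx, ht.trans ?_, hs⟩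
  have h₁ : MvPolynomial.eval ![2 ^ n, Nat.log 2 p] (timeBound k) = k * i.size ^ 3 := by
    simp [timeBound, Inst.size, i]
  rw [h₁, pow_succ' i.size]
  gcongr
  exact bitLen_bound_le i

theorem exists_isStep {n p : ℕ} {d : ℤ} (hn : 1 ≤ n) (h : Compatible p d)
    (hne : ¬ (n = 1 ∧ p % 8 = 3)) : ∃ K, IsStep n K d := by
  obtain ⟨l, rfl⟩ : ∃ l, n = l + 1 := ⟨n - 1, by omega⟩
  rcases h.2 with ⟨h8, hd⟩ | ⟨-, hd⟩
  · obtain ⟨m, rfl⟩ : ∃ m, l = m + 1 := ⟨l - 1, by omega⟩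
    exact ⟨2 ^ m, .inr ⟨hd, by ring⟩⟩
  · exact ⟨2 ^ l, .inl ⟨hd, by ring⟩⟩

theorem IsShortestVector.norm_eq {N : ℕ} {L : AddSubgroup (EuclideanSpace ℝ (Fin N))}
    {v w : EuclideanSpace ℝ (Fin N)} (hv : IsShortestVector L v) (hw : IsShortestVector L w) :
    ‖v‖ = ‖w‖ :=
  le_antisymm (hv.2.2 w hw.1 hw.2.1) (hw.2.2 v hv.1 hv.2.1)

theorem exists_isShortestVector {n p : ℕ} {d : ℤ} {𝔭 : Ideal (CycRing n)} (hn : 1 ≤ n)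
    (hc : Compatible p d) (h𝔭 : 𝔭.IsPrime) (hp𝔭 : (p : CycRing n) ∈ 𝔭)
    (hne : ¬ (n = 1 ∧ p % 8 = 3)) :
    ∃ v, IsShortestVector (idealLattice 𝔭) v ∧ ‖v‖ = √(p : ℝ) := by
  obtain ⟨K, hK⟩ := exists_isStep hn hc hne
  obtain ⟨a, b, hab⟩ := hc.exists_sq_add_mul_sq
  have key : ∀ b : ℤ, a ^ 2 + d * b ^ 2 = p → gen n K d a b ∈ 𝔭 →
      ∃ v, IsShortestVector (idealLattice 𝔭) v ∧ ‖v‖ = √(p : ℝ) := by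
    intro b hab hmem
    refine ⟨_, hc.isShortestVector_gen hn hK hab h𝔭 hmem, ?_⟩
    rw [← Real.sqrt_sq (norm_nonneg _), norm_sq_coeffEmbedding, hK.dot_gen hab, Int.cast_natCast]
  rcases hK.gen_mem_or hab h𝔭 hp𝔭 with h | h
  · exact key b hab h
  · exact key (-b) (by rw [neg_sq, hab]) h

end IdealSVP

theorem theorem1 :
    -- one program finds a shortest nonzero vector in time polynomial in `N = 2^n` and `log p`
    (∃ (c : IdealSVP.Prog) (B : MvPolynomial (Fin 2) ℕ),
      ∀ (n p : ℕ) (𝔭 : Ideal (IdealSVP.CycRing n)) (g : Fin (2 ^ n) → ℤ),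
        1 ≤ n → p.Prime → ((p : ℤ) ≡ 3 [ZMOD 8] ∨ (p : ℤ) ≡ -3 [ZMOD 8]) →
        𝔭.IsPrime → (p : IdealSVP.CycRing n) ∈ 𝔭 →
        (∀ i, |g i| < (p : ℤ)) →
        𝔭 = Ideal.span {(p : IdealSVP.CycRing n), IdealSVP.ofCoeffs n g} →
        ∃ (t : ℕ) (s : IdealSVP.State),
          IdealSVP.Exec c (IdealSVP.inputState (2 ^ n) p g) t s ∧
          t ≤ MvPolynomial.eval ![2 ^ n, Nat.log 2 p] B ∧
          IdealSVP.IsShortestVector (IdealSVP.idealLattice 𝔭)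
            (IdealSVP.toEuclidean (IdealSVP.outputVec (2 ^ n) s))) ∧
    -- the length of a shortest nonzero vector is `√p`
    (∀ (n p : ℕ) (𝔭 : Ideal (IdealSVP.CycRing n)),
      1 ≤ n → p.Prime → ((p : ℤ) ≡ 3 [ZMOD 8] ∨ (p : ℤ) ≡ -3 [ZMOD 8]) →
      𝔭.IsPrime → (p : IdealSVP.CycRing n) ∈ 𝔭 →
      ¬ (n = 1 ∧ (p : ℤ) ≡ 3 [ZMOD 8]) →
      (∃ v, IdealSVP.IsShortestVector (IdealSVP.idealLattice 𝔭) v) ∧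
      ∀ v, IdealSVP.IsShortestVector (IdealSVP.idealLattice 𝔭) v → ‖v‖ = √(p : ℝ)) := by
  refine ⟨?_, ?_⟩
  · obtain ⟨c, B, h⟩ := IdealSVP.exists_program
    exact ⟨c, B, fun n p 𝔭 g hn hp hmod h𝔭 _ hg hspan => h n p 𝔭 g hn hp hmod h𝔭 hg hspan⟩
  · intro n p 𝔭 hn hp hmod h𝔭 hp𝔭 hne
    obtain ⟨d, hc⟩ := IdealSVP.exists_compatible hp hmod
    obtain ⟨v, hv, hnorm⟩ := IdealSVP.exists_isShortestVector hn hc h𝔭 hp𝔭 (by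
      rintro ⟨h₁, h₈⟩
      exact hne ⟨h₁, by unfold Int.ModEq; omega⟩)
    exact ⟨⟨v, hv⟩, fun w hw => (hw.norm_eq hv).trans hnorm⟩
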